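/- **Setting.** Let $\mathcal M$ be a complete, connected, finite-dimensional smooth Riemannian manifold with distance $\mathrm{dist}$. Let $s,R\ge 0$ be integers, $N'=(N'_1,\dots,N'_s)\in\mathbb N^s$, $N=2^R N'$. A signal is a map $u\in\mathcal M^N$ on the grid $\{n\in\mathbb N^s: 0\le n<N\}$, and $\tilde u_{n,r}=u_{2^{R-r}n}$ for $0\le r\le R$, $0\le n<2^rN'$. For real weights $w_j$ let $$\mathrm{mean}(w,x)=\operatorname{argmin}_{v\in\mathcal M}\sum_j w_j\,\mathrm{dist}(v,x_j)^2$$ denote the set of all minimizers. *Subdivision.* Let $a:\mathbb Z^s\to\mathbb R$ be a finitely supported mask which reproduces constants, $\sum_{k\in\mathbb Z^s} a_{n-2k}=1$ for all $n\in\mathbb Z^s$, and is interpolatory, $a_{2k}=\delta_{k0}$. On the finite grids the scheme is completed by an arbitrary boundary rule: real weights $w^{(r)}_{n,j}$ ($0\le n<2^{r}N'$, $0\le j<2^{r-1}N'$) with $\sum_j w^{(r)}_{n,j}=1$ and with $w^{(r)}_{n,j}=a_{n-2j}$ whenever all $k$ with $a_{n-2k}\ne0$ lie in the coarse grid. Put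 $\mathrm S\tilde u_{n,r-1}=\mathrm{mean}(w^{(r)}_{n,\cdot},\tilde u_{\cdot,r-1})$. *Regularizer.* For $1\le r\le R$ the detail $d_{n,r}(u)$ consists of the tangent vectors of smallest Riemannian norm among all $2^{-sr/2}v$, where $v\in T_{\hat u}\mathcal M$, $\exp_{\hat u}v=\tilde u_{n,r}$ and $\hat u\in\mathrm S\tilde u_{n,r-1}$; $\|d_{n,r}(u)\|$ is their common norm. For $q>0$, $\alpha\in\mathbb R$, $\lambda=(\lambda_1,\lambda_2)$, $$\mathcal W^{\alpha,q}_\lambda(u)=\lambda_1\sum_{r=1}^R\sum_n 2^{rq(\alpha+\frac s2-\frac sq)}\|d_{n,r}(u)\|^q+\lambda_2\sum_{n,i}\mathrm{dist}(\tilde u_{n-e_i,0},\tilde u_{n,0})^q ,$$ where the second sum is over all $0\le n<N'$ and $1\le i\le s$ with $n_i\ge1$. *Imaging operator.* Let $K$ be a multiindex, $f\in\mathcal M^K$, and let $A=(a_{ij})$ be a real matrix, rows indexed by the grid of size $K$ and columns by the grid of size $N$, with $\sum_j a_{ij}>0$ for all $i$ (the entries may be negative). Then $\mathcal A(u)_i=\mathrm{mean}(a_{i,\cdot},u)$;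 if this mean is not unique, $\mathcal A(u)_i$ denotes those means which are closest to $f_i$. For $p>0$ let $\mathrm{dist}(\mathcal A(u),f)^p=\sum_i\mathrm{dist}(\mathcal A(u)_i,f_i)^p$, and let $\operatorname{diam}\mathcal A(u)$ be the diameter of the set of all items of $\mathcal A(u)$. **Theorem.** Let $p,q>0$, $\alpha\in\mathbb R$, $\lambda_1>0$ and $\lambda_2=0$, and consider the problem $$\min_{u\in\mathcal M^N}\ \mathrm{dist}(\mathcal A(u),f)^p+\mathcal W_\lambda^{\alpha,q}(u).\qquad(*)$$ 1. If there is a constant $C>0$ such that for every signal $u$, every $0\le n<N'$ and every $i$ with $n_i\ge 1$ $$\mathrm{dist}(\tilde u_{n-e_i,0},\tilde u_{n,0})\le C\max\bigl(\operatorname{diam}\mathcal A(u),\ \mathcal W_\lambda^{\alpha,q}(u)\bigr),$$ then $(*)$ has a minimizer. 2. If $\mathcal A$ is the identity of $\mathcal M^N$ (and $K=N$), then $(*)$ has a minimizer for every $f$. 3. If $\mathcal M$ is compact, then $(*)$ has a minimizer for every such $A$ and $f$. -/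

import Mathlib

open Set Manifold Bundle
open scoped ContDiff Topology

noncomputable section

namespace WaveletReg

/-! ### Grids and sampling -/

/-- The `s`-variate grid of multiindices `n` with `0 ≤ n < N`. -/
abbrev Grid {s : ℕ} (N : Fin s → ℕ) : Type := ∀ ν : Fin s, Fin (N ν)

/-- The size `2 ^ r * N'` of the grid at level `r`. -/
def levelSize {s : ℕ} (N' : Fin s → ℕ) (r : ℕ) : Fin s → ℕ := fun ν => 2 ^ r * N' ν

/-- A grid index, viewed as an element of `ℤ ^ s`. -/
def toInt {s : ℕ} {N : Fin s → ℕ} (n : Grid N) : Fin s → ℤ := fun ν => ((n ν : ℕ) : ℤ)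

theorem sample_lt {m R r k : ℕ} (hr : r ≤ R) (hk : k < 2 ^ r * m) :
    2 ^ (R - r) * k < 2 ^ R * m := by
  calc 2 ^ (R - r) * k < 2 ^ (R - r) * (2 ^ r * m) :=
        Nat.mul_lt_mul_of_pos_left hk (by positivity)
    _ = 2 ^ R * m := by rw [← mul_assoc, ← pow_add, Nat.sub_add_cancel hr]

/-- The samples `ũ_{n,r} = u_{2^{R-r} n}` of a signal `u` at level `r ≤ R`. -/
def sample {s : ℕ} {N' : Fin s → ℕ} {R : ℕ} {M : Type*} (u : Grid (levelSize N' R) → M)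
    (r : ℕ) (hr : r ≤ R) : Grid (levelSize N' r) → M :=
  fun n => u fun ν => ⟨2 ^ (R - r) * (n ν : ℕ), sample_lt hr (n ν).2⟩

/-- The index `n - e_i`; it is only used when `0 < n i`. -/
def pred {s : ℕ} {N : Fin s → ℕ} (n : Grid N) (i : Fin s) : Grid N :=
  Function.update n i ⟨(n i : ℕ) - 1, lt_of_le_of_lt (Nat.sub_le _ _) (n i).2⟩

/-! ### Intrinsic means and interpolatory subdivision -/

/-- The set of intrinsic means: all minimizers `v` of `∑ j, w j * dist(v, x j) ^ 2`. The weights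
may be negative. -/
def intrinsicMean {M : Type*} [MetricSpace M] {ι : Type*} [Fintype ι] (w : ι → ℝ) (x : ι → M) :
    Set M :=
  {v | ∀ y : M, ∑ j, w j * dist v (x j) ^ 2 ≤ ∑ j, w j * dist y (x j) ^ 2}

/-- The data of a dyadic interpolatory subdivision scheme on the grids of sizes `2 ^ r * N'`:
a finitely supported mask on `ℤ ^ s` which reproduces constants and is interpolatory, together with
a boundary rule. The boundary rule provides the averaging weights `weights r n j` with which the
coarse item `j` at level `r` enters the prediction of the fine item `n` at level `r + 1`. It
reproduces constants, and it agrees with the mask at every `n` whose stencil lies in the coarse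
grid. (Periodization, reflection, and tailored boundary rules are all of this form.) -/
structure InterpolatoryScheme {s : ℕ} (N' : Fin s → ℕ) where
  mask : (Fin s → ℤ) → ℝ
  mask_finite : (Function.support mask).Finite
  mask_reproduces : ∀ n : Fin s → ℤ, ∑ᶠ k : Fin s → ℤ, mask (n - 2 • k) = 1
  mask_interpolatory : ∀ k : Fin s → ℤ, mask (2 • k) = if k = 0 then 1 else 0
  weights : ∀ r : ℕ, Grid (levelSize N' (r + 1)) → Grid (levelSize N' r) → ℝ
  weights_reproduces : ∀ r n, ∑ j, weights r n j = 1
  weights_interior : ∀ r (n : Grid (levelSize N' (r + 1))),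
    (∀ k : Fin s → ℤ, mask (toInt n - 2 • k) ≠ 0 →
      ∃ j : Grid (levelSize N' r), toInt j = k) →
    ∀ j : Grid (levelSize N' r), weights r n j = mask (toInt n - 2 • toInt j)

/-- The set `S ũ_{n,r}` of predictions of the `n`-th item at level `r + 1` from the data `x` at
level `r`. -/
def InterpolatoryScheme.predict {s : ℕ} {N' : Fin s → ℕ} (S : InterpolatoryScheme N')
    {M : Type*} [MetricSpace M] (r : ℕ) (x : Grid (levelSize N' r) → M)
    (n : Grid (levelSize N' (r + 1))) : Set M :=
  intrinsicMean (S.weights r n) x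

/-! ### Geodesics and the inverse of the Riemannian exponential map -/

/-- Geodesics `[0,1] → M`: curves that locally realize the Riemannian distance, with constant
speed. -/
def IsGeodesic {M : Type*} [MetricSpace M] (γ : ℝ → M) : Prop :=
  ∃ c : ℝ, 0 ≤ c ∧ ∀ t ∈ Icc (0 : ℝ) 1, ∃ ε > 0,
    ∀ a ∈ Icc (0 : ℝ) 1 ∩ Ioo (t - ε) (t + ε), ∀ b ∈ Icc (0 : ℝ) 1 ∩ Ioo (t - ε) (t + ε),
      dist (γ a) (γ b) = c * |a - b|

section Manifold

variable {d : ℕ} {M : Type*} [MetricSpace M] [ChartedSpace (EuclideanSpace ℝ (Fin d)) M]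

/-- `expInv x y` is `exp_x⁻¹(y)`: the set of all tangent vectors `v` at `x` with `exp_x v = y`,
that is, the initial velocities of the geodesics `γ : [0,1] → M` from `x` to `y`. The vectors are
recorded as elements of the tangent bundle with base point `x`. -/
def expInv (x y : M) : Set (TangentBundle (𝓡 d) M) :=
  {v | ∃ γ : ℝ → M, IsGeodesic γ ∧ γ 0 = x ∧ γ 1 = y ∧
    MDifferentiableWithinAt 𝓘(ℝ, ℝ) (𝓡 d) γ (Icc 0 1) 0 ∧
    v = tangentMapWithin 𝓘(ℝ, ℝ) (𝓡 d) γ (Icc 0 1) ⟨0, (1 : ℝ)⟩}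

variable [IsManifold (𝓡 d) ∞ M] [RiemannianBundle (fun x : M => TangentSpace (𝓡 d) x)]

/-! ### Details and the regularizer -/

variable {s : ℕ} {N' : Fin s → ℕ} {R : ℕ}

/-- All candidates `2^{-s(r+1)/2} (ũ_{n,r+1} ⊖ û)`, `û ∈ S ũ_{n,r}`, for the detail at level
`r + 1` and index `n`. -/
def detailCandidates (S : InterpolatoryScheme N') (u : Grid (levelSize N' R) → M) (r : Fin R)
    (n : Grid (levelSize N' (r + 1))) : Set (TangentBundle (𝓡 d) M) :=
  {δ | ∃ û ∈ S.predict r (sample u r r.2.le) n,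
    ∃ v ∈ expInv (d := d) û (sample u (r + 1) r.2 n),
      δ = ⟨v.1, (2 : ℝ) ^ (-((s : ℝ) * ((r : ℝ) + 1) / 2)) • v.2⟩}

/-- The detail `d_{n,r+1}(u)`: the set of the candidates of smallest Riemannian norm. -/
def detail (S : InterpolatoryScheme N') (u : Grid (levelSize N' R) → M) (r : Fin R)
    (n : Grid (levelSize N' (r + 1))) : Set (TangentBundle (𝓡 d) M) :=
  {δ ∈ detailCandidates S u r n | ∀ δ' ∈ detailCandidates (d := d) S u r n, ‖δ.2‖ ≤ ‖δ'.2‖}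

/-- The Riemannian norm of the detail `d_{n,r+1}(u)`, that is, the common norm of the elements of
`detail S u r n`. -/
def detailNorm (d : ℕ) [ChartedSpace (EuclideanSpace ℝ (Fin d)) M] [IsManifold (𝓡 d) ∞ M]
    [RiemannianBundle (fun x : M => TangentSpace (𝓡 d) x)]
    (S : InterpolatoryScheme N') (u : Grid (levelSize N' R) → M) (r : Fin R)
    (n : Grid (levelSize N' (r + 1))) : ℝ :=
  sInf ((fun δ : TangentBundle (𝓡 d) M => ‖δ.2‖) '' detail S u r n)

/-- The wavelet regularizer `W_λ^{α,q}`, where `λ = (l₁, l₂)`. The level `r + 1` runs through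
`1, …, R`. -/
def regularizer (d : ℕ) [ChartedSpace (EuclideanSpace ℝ (Fin d)) M] [IsManifold (𝓡 d) ∞ M]
    [RiemannianBundle (fun x : M => TangentSpace (𝓡 d) x)]
    (S : InterpolatoryScheme N') (α q l₁ l₂ : ℝ) (u : Grid (levelSize N' R) → M) : ℝ :=
  l₁ * ∑ r : Fin R, ∑ n : Grid (levelSize N' (r + 1)),
      (2 : ℝ) ^ (((r : ℝ) + 1) * q * (α + (s : ℝ) / 2 - (s : ℝ) / q)) * detailNorm d S u r n ^ q
    + l₂ * ∑ n : Grid (levelSize N' 0), ∑ i : Fin s,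
      if 0 < (n i : ℕ) then
        dist (sample u 0 (Nat.zero_le R) (pred n i)) (sample u 0 (Nat.zero_le R) n) ^ q
      else 0

end Manifold

/-! ### Imaging operators and the energy -/

section Operators

variable {M : Type*} [MetricSpace M] {ι κ : Type*}

/-- The imaging operator given by a real matrix: the `i`-th item of `𝒜(u)` is the set of intrinsic
means of `u` with respect to the `i`-th row. -/
def meanOperator [Fintype ι] (a : Matrix κ ι ℝ) (u : ι → M) (i : κ) : Set M :=
  intrinsicMean (a i) u

/-- The identity, as an imaging operator. -/
def idOperator (u : ι → M) (i : ι) : Set M := {u i}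

/-- For non-unique items of `𝒜(u)`, those which minimize the data term are singled out:
the set of the points in the `i`-th item of `𝒜(u)` which are closest to `f i`. -/
def selected (A : (ι → M) → κ → Set M) (f : κ → M) (u : ι → M) (i : κ) : Set M :=
  {v ∈ A u i | ∀ w ∈ A u i, dist v (f i) ≤ dist w (f i)}

/-- The diameter of `𝒜(u)`. -/
def imageDiam (A : (ι → M) → κ → Set M) (f : κ → M) (u : ι → M) : ℝ :=
  Metric.diam (⋃ i, selected A f u i)

/-- The data term `dist(𝒜(u), f)^p = ∑ i, dist(𝒜(u)_i, f_i)^p`. All elements of `selected A f u i`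
have the same distance to `f i`. -/
def dataTerm [Fintype κ] (p : ℝ) (A : (ι → M) → κ → Set M) (f : κ → M) (u : ι → M) : ℝ :=
  ∑ i, Metric.infDist (f i) (selected A f u i) ^ p

end Operators

end WaveletReg

end

/-!
The proof is the direct method of the calculus of variations: the energy is lower semicontinuous,
its sublevel sets are bounded, and `M` is a proper metric space by the Hopf–Rinow theorem
(`HasAlmostGeodesics.properSpace`).

*Details are distances.* The norm of a detail is, up to a power of `2`, the distance between an
item and the set of its predictions (`detailNorm_eq`). This needs two facts. First, some geodesic
realizes the distance of two given points (`HasAlmostGeodesics.exists_geodesic`). Second, a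
geodesic in the metric sense has an initial velocity, and the norm of the latter is the speed
(`mdifferentiableWithinAt_of_dist_eq`). The second fact is shown without the geodesic equation.
Since the metric is differentiable, the chart at `x`, with values in the Euclidean space `T_x M`,
preserves distances near `x` up to relative errors of first order (`exists_tangentChart_bounds`).
A curve `z` in a Euclidean space whose chords have the lengths `c * |t - s|` up to such errors has
nearly degenerate triangles `0`, `z s`, `z t`, and Stewart's theorem shows that `z t / t`
satisfies a Cauchy condition with the rate `√t` (`exists_hasDerivWithinAt_of_chord_bounds`).

*Lower semicontinuity.* Weights with positive sum make the sum of weighted squared distances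
coercive even if some weights are negative, with a bound that is uniform for bounded data
(`dist_le_meanRadius_mul`). Thus the set of intrinsic means is nonempty, locally bounded, and has
a closed graph in its dependence on the data, so that the distance to it is lower semicontinuous
(`lowerSemicontinuous_infDist_intrinsicMean`). Data term and regularizer are sums of increasing
functions of such distances.

*Bounded sublevel sets.* For the identity the data term bounds the signal, and on a compact
manifold there is nothing to show. In the remaining case, bounds on the data term and the
regularizer bound the differences of neighbours on the coarsest level. A bounded regularizer
bounds the distance of items to their predictions, and predictions stay close to the coarse data,
so by induction on the level the signal has bounded diameter (`exists_dist_sample_le`). Finally, a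
mean of the signal is close both to the signal and to the corresponding item of `f`
(`isBounded_sublevel`).
-/

namespace WaveletReg

/-! ### Curves with almost Euclidean distances are differentiable at their starting point -/

section Derivative

variable {F : Type*} [NormedAddCommGroup F] [InnerProductSpace ℝ F]

/-- Stewart's theorem. -/
theorem norm_sub_smul_sq (a c : F) (l : ℝ) :
    ‖a - l • c‖ ^ 2 = (1 - l) * ‖a‖ ^ 2 + l * ‖a - c‖ ^ 2 - l * (1 - l) * ‖c‖ ^ 2 := by
  rw [norm_sub_sq_real, norm_sub_sq_real, norm_smul, inner_smul_right, mul_pow, Real.norm_eq_abs,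
    sq_abs]
  ring

variable {z : ℝ → F} {c C ε : ℝ}

/-- Difference quotients at comparable times `t / 2 ≤ s ≤ t` differ by `O(√t)`: by Stewart's theorem
`z s` is close to the point of the segment from `0` to `z t` at parameter `s / t`, because in the
triangle `0`, `z s`, `z t` the sides are almost additive. -/
theorem dist_slope_le_of_half_le (hc : 0 ≤ c) (hC : 0 ≤ C)
    (hz : ∀ s t, 0 ≤ s → s ≤ t → t < ε → ‖z s - z t‖ ≤ (1 + C * t) * (c * (t - s)))
    (hz0 : z 0 = 0)
    (hz' : ∀ t, 0 ≤ t → t < ε → (1 - C * t) * (c * t) ≤ ‖z t‖)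
    (hε : C * ε ≤ 1) {s t : ℝ} (ht : 0 < t) (hs : t / 2 ≤ s) (hst : s ≤ t) (htε : t < ε) :
    ‖s⁻¹ • z s - t⁻¹ • z t‖ ≤ 2 * c * √C * √t := by
  have hs0 : 0 < s := by linarith
  set l := s / t with hl
  have hsl : s = l * t := by rw [hl]; field_simp
  have hl1 : l ≤ 1 := by rw [hl, div_le_one ht]; exact hst
  have hl2 : 1 / 2 ≤ l := by rw [hl, le_div_iff₀ ht]; linarith
  have hCt : C * t ≤ 1 := le_trans (by gcongr) hε
  have hCt0 : 0 ≤ C * t := by positivity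
  have e : s⁻¹ • z s - t⁻¹ • z t = s⁻¹ • (z s - l • z t) := by
    rw [smul_sub, smul_smul]; congr 2; rw [hl]; field_simp
  have h1 : ‖z s‖ ≤ (1 + C * t) * (c * s) := by
    have := hz 0 s le_rfl hs0.le (by linarith)
    simp only [hz0, zero_sub, norm_neg, sub_zero] at this
    refine this.trans ?_
    gcongr
  have h2 : ‖z s - z t‖ ≤ (1 + C * t) * (c * (t - s)) := hz s t hs0.le hst htε
  have h3 := hz' t ht.le htε
  have h3' : 0 ≤ (1 - C * t) * (c * t) := mul_nonneg (by linarith) (by positivity)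
  have key : ‖z s - l • z t‖ ^ 2 ≤ (c * s * √C * √t * 2) ^ 2 := by
    rw [norm_sub_smul_sq]
    have a1 : ‖z s‖ ^ 2 ≤ ((1 + C * t) * (c * s)) ^ 2 := by gcongr
    have a2 : ‖z s - z t‖ ^ 2 ≤ ((1 + C * t) * (c * (t - s))) ^ 2 := by gcongr
    have a3 : ((1 - C * t) * (c * t)) ^ 2 ≤ ‖z t‖ ^ 2 := by gcongr
    have b1 : (1 - l) * ‖z s‖ ^ 2 ≤ (1 - l) * ((1 + C * t) * (c * s)) ^ 2 := by
      gcongr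
    have b2 : l * ‖z s - z t‖ ^ 2 ≤ l * ((1 + C * t) * (c * (t - s))) ^ 2 := by
      gcongr
    have b3 : l * (1 - l) * ((1 - C * t) * (c * t)) ^ 2 ≤ l * (1 - l) * ‖z t‖ ^ 2 := by
      have : 0 ≤ l * (1 - l) := mul_nonneg (by linarith) (by linarith)
      gcongr
    have e1 : (1 - l) * ((1 + C * t) * (c * s)) ^ 2 + l * ((1 + C * t) * (c * (t - s))) ^ 2
        - l * (1 - l) * ((1 - C * t) * (c * t)) ^ 2 = l * (1 - l) * (4 * C * t) * (c * t) ^ 2 := by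
      rw [hsl]; ring
    have e2 : (c * s * √C * √t * 2) ^ 2 = 4 * C * t * (c * s) ^ 2 := by
      rw [mul_pow, mul_pow, mul_pow, Real.sq_sqrt hC, Real.sq_sqrt ht.le]; ring
    rw [e2, hsl]
    have e3 : l * (1 - l) * (4 * C * t) * (c * t) ^ 2 ≤ 4 * C * t * (c * (l * t)) ^ 2 := by
      have : l * (1 - l) ≤ l ^ 2 := by nlinarith
      calc l * (1 - l) * (4 * C * t) * (c * t) ^ 2 ≤ l ^ 2 * (4 * C * t) * (c * t) ^ 2 := by gcongr
        _ = _ := by ring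
    rw [← hsl]
    rw [← hsl] at e3
    linarith
  have k2 : ‖z s - l • z t‖ ≤ c * s * √C * √t * 2 := (abs_le_of_sq_le_sq' key (by positivity)).2
  rw [e, norm_smul, norm_inv, Real.norm_of_nonneg hs0.le, inv_mul_le_iff₀ hs0]
  linarith

/-- Difference quotients at arbitrary times `s ≤ t` differ by `O(√t)`, by summing the geometric
series of the errors at the times `t, t / 2, t / 4, …`. -/
theorem dist_slope_le (hc : 0 ≤ c) (hC : 0 ≤ C)
    (hz : ∀ s t, 0 ≤ s → s ≤ t → t < ε → ‖z s - z t‖ ≤ (1 + C * t) * (c * (t - s)))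
    (hz0 : z 0 = 0)
    (hz' : ∀ t, 0 ≤ t → t < ε → (1 - C * t) * (c * t) ≤ ‖z t‖)
    (hε : C * ε ≤ 1) {s t : ℝ} (hs : 0 < s) (hst : s ≤ t) (htε : t < ε) :
    ‖s⁻¹ • z s - t⁻¹ • z t‖ ≤ 8 * c * √C * √t := by
  -- induction on the number of halvings that bring `t` below `2 * s`
  have main : ∀ n : ℕ, ∀ t : ℝ, s ≤ t → t < ε → t ≤ 2 ^ n * s →
      ‖s⁻¹ • z s - t⁻¹ • z t‖ ≤ 8 * c * √C * √t := by
    intro n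
    induction n with
    | zero =>
      intro t h1 _ h3
      have : s = t := le_antisymm h1 (by simpa using h3)
      subst this
      simp only [sub_self, norm_zero]
      positivity
    | succ n ih =>
      intro t h1 h2 h3
      have ht : 0 < t := hs.trans_le h1
      rcases le_total (t / 2) s with h | h
      · refine (dist_slope_le_of_half_le hc hC hz hz0 hz' hε ht h h1 h2).trans ?_
        gcongr
        norm_num
      · have i1 := ih (t / 2) h (by linarith) (by rw [pow_succ] at h3; linarith)
        have i2 := dist_slope_le_of_half_le hc hC hz hz0 hz' hε ht le_rfl (by linarith) h2
        have i3 : √(t / 2) ≤ 3 / 4 * √t := by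
          rw [Real.sqrt_le_left (by positivity), mul_pow, Real.sq_sqrt ht.le]
          linarith
        have i4 : 8 * c * √C * √(t / 2) ≤ 8 * c * √C * (3 / 4 * √t) := by gcongr
        have i5 := norm_sub_le_norm_sub_add_norm_sub (s⁻¹ • z s) ((t / 2)⁻¹ • z (t / 2))
          (t⁻¹ • z t)
        linarith
  obtain ⟨n, hn⟩ := pow_unbounded_of_one_lt (t / s) (by norm_num : (1 : ℝ) < 2)
  exact main n t hst htε (by rw [div_lt_iff₀ hs] at hn; exact hn.le)

/-- If the chord lengths of a curve `z` agree with those of a straight line of speed `c` up to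
relative errors of first order, then `z` has a one-sided derivative at `0`, of norm `c`. -/
theorem exists_hasDerivWithinAt_of_chord_bounds [CompleteSpace F] (hc : 0 ≤ c) (hC : 0 ≤ C)
    (hε0 : 0 < ε)
    (hz : ∀ s t, 0 ≤ s → s ≤ t → t < ε → ‖z s - z t‖ ≤ (1 + C * t) * (c * (t - s)))
    (hz0 : z 0 = 0)
    (hz' : ∀ t, 0 ≤ t → t < ε → (1 - C * t) * (c * t) ≤ ‖z t‖) :
    ∃ v : F, HasDerivWithinAt z v (Ici 0) 0 ∧ ‖v‖ = c := by
  wlog hε : C * ε ≤ 1 generalizing ε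
  · refine this (ε := min ε (C + 1)⁻¹) (lt_min hε0 (by positivity))
      (fun s t h1 h2 h3 => hz s t h1 h2 (lt_min_iff.1 h3).1)
      (fun t h1 h2 => hz' t h1 (lt_min_iff.1 h2).1) ?_
    calc C * min ε (C + 1)⁻¹ ≤ (C + 1) * (C + 1)⁻¹ := by
          gcongr
          · linarith
          · exact min_le_right _ _
      _ = 1 := mul_inv_cancel₀ (by positivity)
  have hcauchy : Cauchy (Filter.map (fun t => t⁻¹ • z t) (𝓝[>] (0 : ℝ))) := by
    rw [Metric.cauchy_iff]
    refine ⟨inferInstance, fun η hη => ?_⟩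
    have ht : Filter.Tendsto (fun t : ℝ => 8 * c * √C * √t) (𝓝[>] 0) (𝓝 0) := by
      have : Filter.Tendsto (fun t : ℝ => 8 * c * √C * √t) (𝓝[>] 0) (𝓝 (8 * c * √C * √0)) :=
        ((Real.continuous_sqrt.tendsto 0).mono_left nhdsWithin_le_nhds).const_mul _
      simpa using this
    have h1 : ∀ᶠ t : ℝ in 𝓝[>] 0, 8 * c * √C * √t < η ∧ t < ε ∧ 0 < t :=
      (ht.eventually_lt_const hη).and
        (Filter.Eventually.and (nhdsWithin_le_nhds (Iio_mem_nhds hε0)) self_mem_nhdsWithin)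
    refine ⟨_, Filter.image_mem_map h1, ?_⟩
    rintro _ ⟨a, ⟨ha1, ha2, ha3⟩, rfl⟩ _ ⟨b, ⟨hb1, hb2, hb3⟩, rfl⟩
    rw [dist_eq_norm]
    rcases le_total a b with h | h
    · exact (dist_slope_le hc hC hz hz0 hz' hε ha3 h hb2).trans_lt hb1
    · rw [norm_sub_rev]
      exact (dist_slope_le hc hC hz hz0 hz' hε hb3 h ha2).trans_lt ha1
  obtain ⟨v, hv⟩ := CompleteSpace.complete hcauchy
  have hv : Filter.Tendsto (fun t => t⁻¹ • z t) (𝓝[>] (0 : ℝ)) (𝓝 v) := hv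
  refine ⟨v, ?_, ?_⟩
  · rw [hasDerivWithinAt_iff_tendsto_slope]
    have : slope z 0 = fun t => t⁻¹ • z t := by
      funext t
      simp [slope_def_module, hz0]
    rw [Ici_sdiff_left, this]
    exact hv
  · have hid : Filter.Tendsto (fun t : ℝ => t) (𝓝[>] 0) (𝓝 0) := nhdsWithin_le_nhds
    have l1 : Filter.Tendsto (fun t : ℝ => (1 - C * t) * c) (𝓝[>] 0) (𝓝 c) := by
      simpa using ((hid.const_mul C).const_sub 1).mul_const c
    have l2 : Filter.Tendsto (fun t : ℝ => (1 + C * t) * c) (𝓝[>] 0) (𝓝 c) := by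
      simpa using ((hid.const_mul C).const_add 1).mul_const c
    have hev : ∀ᶠ t : ℝ in 𝓝[>] 0, t < ε ∧ 0 < t :=
      Filter.Eventually.and (nhdsWithin_le_nhds (Iio_mem_nhds hε0)) self_mem_nhdsWithin
    refine tendsto_nhds_unique hv.norm (tendsto_of_tendsto_of_tendsto_of_le_of_le' l1 l2 ?_ ?_)
    · filter_upwards [hev] with t ⟨h1, h2⟩
      rw [norm_smul, norm_inv, Real.norm_of_nonneg h2.le, le_inv_mul_iff₀ h2]
      have := hz' t h2.le h1
      linarith
    · filter_upwards [hev] with t ⟨h1, h2⟩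
      rw [norm_smul, norm_inv, Real.norm_of_nonneg h2.le, inv_mul_le_iff₀ h2]
      have := hz 0 t le_rfl h2.le h1
      simp only [hz0, zero_sub, norm_neg, sub_zero] at this
      linarith

end Derivative

/-! ### A Riemannian metric is Lipschitz continuous in coordinates -/

section Bundle
open ContinuousLinearMap

variable
  {EB : Type*} [NormedAddCommGroup EB] [NormedSpace ℝ EB]
  {B : Type*} [TopologicalSpace B] [ChartedSpace EB B]
  {F : Type*} [NormedAddCommGroup F] [NormedSpace ℝ F]
  {E : B → Type*} [TopologicalSpace (TotalSpace F E)] [∀ x, NormedAddCommGroup (E x)]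
  [∀ x, InnerProductSpace ℝ (E x)] [FiberBundle F E] [VectorBundle ℝ F E]
  [IsManifold 𝓘(ℝ, EB) 1 B]
  [h : IsContMDiffRiemannianBundle 𝓘(ℝ, EB) 1 F E]

set_option synthInstance.maxHeartbeats 200000 in
include h in
variable (EB F E) in
/-- In the trivialization at `x`, a `C¹` Riemannian metric is a family of bilinear forms on the
model fibre that is Lipschitz at `x`. -/
theorem exists_metric_coords (x : B) : ∃ g' : B → F →L[ℝ] F →L[ℝ] ℝ, ∃ K : ℝ, 0 ≤ K ∧
    (∀ᶠ y in 𝓝 x,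
      ‖g' y - g' x‖ ≤ K * ‖extChartAt 𝓘(ℝ, EB) x y - extChartAt 𝓘(ℝ, EB) x x‖) ∧
    ∀ y ∈ (trivializationAt F E x).baseSet, ∀ w : F,
      ‖(trivializationAt F E x).symmL ℝ y w‖ ^ 2 = g' y w w := by
  rcases h.exists_contMDiff with ⟨g, g_smooth, hg⟩
  let g' : B → F →L[ℝ] F →L[ℝ] ℝ := fun y ↦
    inCoordinates F E (F →L[ℝ] ℝ) (fun x ↦ E x →L[ℝ] ℝ) x y x y (g y)
  have hg' : ContMDiffAt 𝓘(ℝ, EB) 𝓘(ℝ, F →L[ℝ] F →L[ℝ] ℝ) 1 g' x := by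
    have W := g_smooth.contMDiffAt (x := x)
    simp only [contMDiffAt_hom_bundle] at W
    exact W.2
  have h1 : ContDiffAt ℝ 1 (g' ∘ (extChartAt 𝓘(ℝ, EB) x).symm) (extChartAt 𝓘(ℝ, EB) x x) := by
    rw [← contMDiffAt_iff_contDiffAt]
    have h2 : ContMDiffAt 𝓘(ℝ, EB) 𝓘(ℝ, EB) 1 (extChartAt 𝓘(ℝ, EB) x).symm
        (extChartAt 𝓘(ℝ, EB) x x) :=
      (contMDiffOn_extChartAt_symm x).contMDiffAt (extChartAt_target_mem_nhds x)
    refine ContMDiffAt.comp (extChartAt 𝓘(ℝ, EB) x x) ?_ h2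
    rwa [extChartAt_to_inv]
  obtain ⟨K, t, ht, hK⟩ := h1.exists_lipschitzOnWith
  refine ⟨g', K, K.2, ?_, ?_⟩
  · filter_upwards [(continuousAt_extChartAt (I := 𝓘(ℝ, EB)) x).preimage_mem_nhds ht,
      extChartAt_source_mem_nhds (I := 𝓘(ℝ, EB)) x] with y hy h'y
    have := hK.dist_le_mul _ (mem_preimage.1 hy) _ (mem_of_mem_nhds ht)
    rwa [dist_eq_norm, dist_eq_norm, Function.comp_apply, Function.comp_apply,
      (extChartAt 𝓘(ℝ, EB) x).left_inv h'y, extChartAt_to_inv] at this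
  · intro y hy w
    rw [← real_inner_self_eq_norm_sq, hg]
    simp only [g']
    rw [inCoordinates_apply_eq₂ hy hy (Set.mem_univ _)]
    simp [hy]

set_option synthInstance.maxHeartbeats 200000 in
include h in
variable (EB F E) in
/-- Local trivializations of a `C¹` Riemannian metric distort norms by a factor
`1 + O(‖φ y - φ x‖)`, where `φ` is the chart at `x`. -/
theorem exists_symmL_bounds (x : B) : ∃ C : ℝ, 0 ≤ C ∧ ∀ᶠ y in 𝓝 x, ∀ w : F,
    ‖(trivializationAt F E x).symmL ℝ x w‖ ≤
      (1 + C * ‖extChartAt 𝓘(ℝ, EB) x y - extChartAt 𝓘(ℝ, EB) x x‖) *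
        ‖(trivializationAt F E x).symmL ℝ y w‖ ∧
    ‖(trivializationAt F E x).symmL ℝ y w‖ ≤
      (1 + C * ‖extChartAt 𝓘(ℝ, EB) x y - extChartAt 𝓘(ℝ, EB) x x‖) *
        ‖(trivializationAt F E x).symmL ℝ x w‖ := by
  obtain ⟨g', K, hK, hg, hs⟩ := exists_metric_coords EB F E x
  have hxx : x ∈ (trivializationAt F E x).baseSet :=
    FiberBundle.mem_baseSet_trivializationAt' x
  let G := (trivializationAt F E x).continuousLinearEquivAt ℝ x hxx
  have hG : ∀ w : F, ‖w‖ ≤ ‖(G : E x →L[ℝ] F)‖ * ‖(trivializationAt F E x).symmL ℝ x w‖ := by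
    intro w
    have h1 := (G : E x →L[ℝ] F).le_opNorm (G.symm w)
    have h2 : (G : E x →L[ℝ] F) (G.symm w) = w := G.apply_symm_apply w
    rw [h2] at h1
    simpa [G, hxx] using h1
  set c := ‖(G : E x →L[ℝ] F)‖ ^ 2 with hc
  have hcont : Filter.Tendsto
      (fun y => K * c * ‖extChartAt 𝓘(ℝ, EB) x y - extChartAt 𝓘(ℝ, EB) x x‖) (𝓝 x) (𝓝 0) := by
    have := (((continuousAt_extChartAt (I := 𝓘(ℝ, EB)) x).sub
      (continuousAt_const (y := extChartAt 𝓘(ℝ, EB) x x))).norm.const_mul (K * c))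
    simpa [ContinuousAt] using this
  refine ⟨2 * (K * c), by positivity, ?_⟩
  filter_upwards [hg, (trivializationAt F E x).open_baseSet.mem_nhds hxx,
    hcont.eventually_le_const (by norm_num : (0:ℝ) < 1/2)] with y hy hys hyc w
  have e1 := hs y hys w
  have e2 := hs x hxx w
  set a := ‖(trivializationAt F E x).symmL ℝ x w‖
  set b := ‖(trivializationAt F E x).symmL ℝ y w‖
  set D := ‖extChartAt 𝓘(ℝ, EB) x y - extChartAt 𝓘(ℝ, EB) x x‖
  have ha : 0 ≤ a := norm_nonneg _
  have hb : 0 ≤ b := norm_nonneg _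
  have key : |b ^ 2 - a ^ 2| ≤ K * c * D * a ^ 2 := by
    have h1 : b ^ 2 - a ^ 2 = (g' y - g' x) w w := by simp [e1, e2]
    rw [h1, ← Real.norm_eq_abs]
    calc ‖(g' y - g' x) w w‖ ≤ ‖g' y - g' x‖ * ‖w‖ * ‖w‖ := le_opNorm₂ _ _ _
      _ ≤ (K * D) * (‖(G : E x →L[ℝ] F)‖ * a) * (‖(G : E x →L[ℝ] F)‖ * a) := by
        gcongr
        · exact hG w
        · exact hG w
      _ = K * c * D * a ^ 2 := by rw [hc]; ring
  obtain ⟨k1, k2⟩ := abs_le.1 key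
  have hD : 0 ≤ K * c * D := by positivity
  set m := K * c * D
  have hm : 2 * (K * c) * D = 2 * m := by simp only [m]; ring
  rw [hm]
  constructor
  · refine abs_le_of_sq_le_sq' ?_ (by positivity) |>.2
    have : (1 - m) * a ^ 2 ≤ b ^ 2 := by linarith
    have h2 : 1 ≤ (1 + 2 * m) ^ 2 * (1 - m) := by
      nlinarith [mul_nonneg hD hD, mul_nonneg hD (mul_nonneg hD hD)]
    calc a ^ 2 ≤ ((1 + 2 * m) ^ 2 * (1 - m)) * a ^ 2 := le_mul_of_one_le_left (sq_nonneg _) h2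
      _ = (1 + 2 * m) ^ 2 * ((1 - m) * a ^ 2) := by ring
      _ ≤ (1 + 2 * m) ^ 2 * b ^ 2 := by gcongr
      _ = _ := by ring
  · refine abs_le_of_sq_le_sq' ?_ (by positivity) |>.2
    have : b ^ 2 ≤ (1 + m) * a ^ 2 := by linarith
    refine this.trans ?_
    rw [mul_pow]
    gcongr
    nlinarith
end Bundle

/-! ### Distances in the chart at a point -/

section Coordinates
open MeasureTheory

variable {E : Type*} [NormedAddCommGroup E] [NormedSpace ℝ E]
  {M : Type*} [MetricSpace M] [ChartedSpace E M] [IsManifold 𝓘(ℝ, E) 1 M]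
  [RiemannianBundle (fun x : M => TangentSpace 𝓘(ℝ, E) x)]

variable (E) in
/-- The chart at `x`, with values in the tangent space at `x`, sending `x` to `0` and with
derivative the identity at `x`. -/
noncomputable def tangentChart (x y : M) : TangentSpace 𝓘(ℝ, E) x :=
  (trivializationAt E (TangentSpace 𝓘(ℝ, E)) x).symmL ℝ x
    (extChartAt 𝓘(ℝ, E) x y - extChartAt 𝓘(ℝ, E) x x)

variable [IsRiemannianManifold 𝓘(ℝ, E) M]

omit [IsManifold 𝓘(ℝ, E) 1 M] in
theorem ofReal_dist_eq (x y : M) : ENNReal.ofReal (dist x y) = riemannianEDist 𝓘(ℝ, E) x y := by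
  rw [← edist_dist, IsRiemannianManifold.out (I := 𝓘(ℝ, E)) x y]

/-- If the chart at `x` expands tangent vectors at most by the factor `k` on the ball of radius
`4 * ρ`, then it is `k`-Lipschitz on the ball of radius `ρ`: almost shortest curves between points
of the smaller ball stay in the larger one. -/
theorem norm_tangentChart_sub_le {x : M} {ρ k : ℝ} (hk : 0 ≤ k)
    (h : ∀ y, dist x y < 4 * ρ → y ∈ (chartAt E x).source ∧ ∀ v : TangentSpace 𝓘(ℝ, E) y,
      ‖(trivializationAt E (TangentSpace 𝓘(ℝ, E)) x).symmL ℝ x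
        (mfderiv 𝓘(ℝ, E) 𝓘(ℝ, E) (extChartAt 𝓘(ℝ, E) x) y v)‖ ≤ k * ‖v‖)
    {p q : M} (hp : dist x p < ρ) (hq : dist x q < ρ) :
    ‖tangentChart E x p - tangentChart E x q‖ ≤ k * dist p q := by
  set S : E →L[ℝ] TangentSpace 𝓘(ℝ, E) x :=
    (trivializationAt E (TangentSpace 𝓘(ℝ, E)) x).symmL ℝ x with hS
  set φ := extChartAt 𝓘(ℝ, E) x with hφ
  have hpq : dist p q < 2 * ρ := by
    linarith [dist_triangle p x q, dist_comm p x]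
  -- compare with a curve from `p` to `q` of length less than `r`, then let `r` tend to `dist p q`
  have main : ∀ r : ℝ, dist p q < r → r < 3 * ρ →
      ‖tangentChart E x p - tangentChart E x q‖ ≤ k * r := by
    intro r hr hr3
    have hr0 : 0 < r := dist_nonneg.trans_lt hr
    have hr' : riemannianEDist 𝓘(ℝ, E) p q < ENNReal.ofReal r := by
      rw [← ofReal_dist_eq]
      exact (ENNReal.ofReal_lt_ofReal_iff hr0).2 hr
    obtain ⟨γ, hγ0, hγ1, hγ, hlen, -⟩ :=
      exists_lt_locally_constant_of_riemannianEDist_lt hr' zero_lt_one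
    have hmem : ∀ t ∈ Icc (0 : ℝ) 1, dist x (γ t) < 4 * ρ := by
      intro t ht
      have h1 : riemannianEDist 𝓘(ℝ, E) p (γ t) ≤ pathELength 𝓘(ℝ, E) γ 0 t :=
        riemannianEDist_le_pathELength hγ.contMDiffOn hγ0 rfl ht.1
      have h2 : pathELength 𝓘(ℝ, E) γ 0 t ≤ pathELength 𝓘(ℝ, E) γ 0 1 :=
        pathELength_mono le_rfl ht.2
      have h3 := (h1.trans h2).trans_lt hlen
      rw [← ofReal_dist_eq, ENNReal.ofReal_lt_ofReal_iff hr0] at h3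
      linarith [dist_triangle x p (γ t)]
    have hφγ : ContMDiffOn 𝓘(ℝ, ℝ) 𝓘(ℝ, E) 1 (φ ∘ γ) (Icc 0 1) :=
      contMDiffOn_extChartAt.comp (t := (chartAt E x).source)
        hγ.contMDiffOn (fun t ht => (h _ (hmem t ht)).1)
    have hφγ' : ContDiffOn ℝ 1 (φ ∘ γ) (Icc 0 1) := contMDiffOn_iff_contDiffOn.1 hφγ
    have hψγ : ContDiffOn ℝ 1 (fun t => S (φ (γ t) - φ x)) (Icc 0 1) :=
      S.contDiff.comp_contDiffOn (hφγ'.sub contDiffOn_const)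
    have hder : ∀ t ∈ Icc (0 : ℝ) 1, ‖derivWithin (fun t => S (φ (γ t) - φ x)) (Icc 0 1) t‖ₑ ≤
        ENNReal.ofReal k * ‖mfderivWithin 𝓘(ℝ, ℝ) 𝓘(ℝ, E) γ (Icc 0 1) t 1‖ₑ := by
      intro t ht
      have hu := uniqueDiffOn_Icc zero_lt_one t ht
      have e1 : HasDerivWithinAt (φ ∘ γ) (derivWithin (φ ∘ γ) (Icc 0 1) t) (Icc 0 1) t :=
        ((hφγ'.differentiableOn one_ne_zero) t ht).hasDerivWithinAt
      have e2 : derivWithin (fun t => S (φ (γ t) - φ x)) (Icc 0 1) t =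
          S (derivWithin (φ ∘ γ) (Icc 0 1) t) :=
        (S.hasFDerivAt.comp_hasDerivWithinAt t (e1.sub_const (φ x))).derivWithin hu
      have e3 : mfderivWithin 𝓘(ℝ, ℝ) 𝓘(ℝ, E) (φ ∘ γ) (Icc 0 1) t =
          (mfderiv 𝓘(ℝ, E) 𝓘(ℝ, E) φ (γ t)) ∘L (mfderivWithin 𝓘(ℝ, ℝ) 𝓘(ℝ, E) γ (Icc 0 1) t) := by
        apply mfderiv_comp_mfderivWithin
        · exact mdifferentiableAt_extChartAt (h _ (hmem t ht)).1
        · exact (hγ.mdifferentiable one_ne_zero).mdifferentiableOn _ ht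
        · rwa [uniqueMDiffWithinAt_iff_uniqueDiffWithinAt]
      have e4 : derivWithin (φ ∘ γ) (Icc 0 1) t =
          mfderiv 𝓘(ℝ, E) 𝓘(ℝ, E) φ (γ t) (mfderivWithin 𝓘(ℝ, ℝ) 𝓘(ℝ, E) γ (Icc 0 1) t 1) := by
        rw [← fderivWithin_derivWithin, ← mfderivWithin_eq_fderivWithin]
        exact congr($e3 1)
      rw [e2, e4, ← ofReal_norm, ← ofReal_norm, ← ENNReal.ofReal_mul hk]
      exact ENNReal.ofReal_le_ofReal ((h _ (hmem t ht)).2 _)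
    have hfin := enorm_sub_le_lintegral_derivWithin_Icc_of_contDiffOn_Icc hψγ zero_le_one
    have hfin2 : ‖S (φ (γ 1) - φ x) - S (φ (γ 0) - φ x)‖ₑ ≤
        ENNReal.ofReal k * ENNReal.ofReal r := by
      refine hfin.trans ((setLIntegral_mono' measurableSet_Icc hder).trans ?_)
      rw [lintegral_const_mul' _ _ ENNReal.ofReal_ne_top,
        ← pathELength_eq_lintegral_mfderivWithin_Icc]
      gcongr
    rw [hγ0, hγ1, ← ENNReal.ofReal_mul hk, ← ofReal_norm,
      ENNReal.ofReal_le_ofReal_iff (by positivity), norm_sub_rev] at hfin2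
    exact hfin2
  have hcont : Filter.Tendsto (fun r : ℝ => k * r) (𝓝[>] (dist p q)) (𝓝 (k * dist p q)) :=
    (Filter.Tendsto.const_mul k Filter.tendsto_id).mono_left nhdsWithin_le_nhds
  refine ge_of_tendsto hcont ?_
  filter_upwards [self_mem_nhdsWithin, nhdsWithin_le_nhds (Iio_mem_nhds
    (by linarith [dist_nonneg (x := x) (y := p)] : dist p q < 3 * ρ))] with r h1 h2
  exact main r h1 h2

/-- If the inverse of the chart at `x` expands tangent vectors at most by the factor `k` on a ball
around `0` in `T_x M` that contains the image of `y`, then `dist x y` is at most `k` times the norm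
of that image: the preimage of the segment from `0` to the image of `y` is a competitor. -/
theorem dist_le_mul_norm_tangentChart {x y : M} {k : ℝ} (hk : 0 ≤ k) (hy : y ∈ (chartAt E x).source)
    (h : ∀ z : E, ‖(trivializationAt E (TangentSpace 𝓘(ℝ, E)) x).symmL ℝ x
        (z - extChartAt 𝓘(ℝ, E) x x)‖ ≤ ‖tangentChart E x y‖ →
      z ∈ (extChartAt 𝓘(ℝ, E) x).target ∧ ∀ w : E,
        ‖(trivializationAt E (TangentSpace 𝓘(ℝ, E)) x).symmL ℝ ((extChartAt 𝓘(ℝ, E) x).symm z) w‖ ≤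
          k * ‖(trivializationAt E (TangentSpace 𝓘(ℝ, E)) x).symmL ℝ x w‖) :
    dist x y ≤ k * ‖tangentChart E x y‖ := by
  set S : E →L[ℝ] TangentSpace 𝓘(ℝ, E) x :=
    (trivializationAt E (TangentSpace 𝓘(ℝ, E)) x).symmL ℝ x with hS
  set φ := extChartAt 𝓘(ℝ, E) x with hφ
  have hψ : tangentChart E x y = S (φ y - φ x) := rfl
  let η : ℝ → E := fun t => φ x + t • (φ y - φ x)
  have hη : ∀ t ∈ Icc (0 : ℝ) 1, ‖S (η t - φ x)‖ ≤ ‖tangentChart E x y‖ := by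
    intro t ht
    rw [hψ]
    simp only [η, add_sub_cancel_left, map_smul, norm_smul, Real.norm_of_nonneg ht.1]
    exact mul_le_of_le_one_left (norm_nonneg _) ht.2
  have hη1 : ∀ t, HasDerivAt η (φ y - φ x) t := fun t => by
    simpa [η] using ((hasDerivAt_id t).smul_const (φ y - φ x)).const_add (φ x)
  have hηs : ContMDiff 𝓘(ℝ, ℝ) 𝓘(ℝ, E) 1 η := by
    rw [contMDiff_iff_contDiff]
    exact contDiff_const.add (contDiff_id.smul contDiff_const)
  have hmaps : ∀ t ∈ Icc (0 : ℝ) 1, η t ∈ φ.target := fun t ht => (h _ (hη t ht)).1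
  have hlen : riemannianEDist 𝓘(ℝ, E) x y ≤ pathELength 𝓘(ℝ, E) (φ.symm ∘ η) 0 1 := by
    apply riemannianEDist_le_pathELength _ _ _ zero_le_one
    · exact (contMDiffOn_extChartAt_symm x).comp hηs.contMDiffOn hmaps
    · simp only [η, Function.comp_apply, zero_smul, add_zero]
      exact extChartAt_to_inv x
    · simp only [η, Function.comp_apply, one_smul, add_sub_cancel]
      exact φ.left_inv (by rwa [hφ, extChartAt_source])
  have hbound : pathELength 𝓘(ℝ, E) (φ.symm ∘ η) 0 1 ≤
      ENNReal.ofReal (k * ‖tangentChart E x y‖) := by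
    rw [pathELength_eq_lintegral_mfderivWithin_Icc]
    calc ∫⁻ t in Icc (0 : ℝ) 1, ‖mfderivWithin 𝓘(ℝ, ℝ) 𝓘(ℝ, E) (φ.symm ∘ η) (Icc 0 1) t 1‖ₑ
        ≤ ∫⁻ _ in Icc (0 : ℝ) 1, ENNReal.ofReal (k * ‖tangentChart E x y‖) := by
          refine setLIntegral_mono' measurableSet_Icc fun t ht => ?_
          have hu := uniqueDiffOn_Icc zero_lt_one t ht
          have hsrc : φ.symm (η t) ∈ (chartAt E x).source := by
            rw [← extChartAt_source 𝓘(ℝ, E) x]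
            exact φ.map_target (hmaps t ht)
          have e1 : mfderivWithin 𝓘(ℝ, ℝ) 𝓘(ℝ, E) (φ.symm ∘ η) (Icc 0 1) t =
              (mfderivWithin 𝓘(ℝ, E) 𝓘(ℝ, E) φ.symm (range 𝓘(ℝ, E)) (η t)) ∘L
                (mfderivWithin 𝓘(ℝ, ℝ) 𝓘(ℝ, E) η (Icc 0 1) t) := by
            apply mfderivWithin_comp
            · exact mdifferentiableWithinAt_extChartAt_symm (hmaps t ht)
            · exact hηs.contMDiffOn.mdifferentiableOn one_ne_zero t ht
            · exact fun s hs => extChartAt_target_subset_range x (hmaps s hs)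
            · rwa [uniqueMDiffWithinAt_iff_uniqueDiffWithinAt]
          have e2 : mfderivWithin 𝓘(ℝ, ℝ) 𝓘(ℝ, E) η (Icc 0 1) t 1 = φ y - φ x := by
            rw [mfderivWithin_eq_fderivWithin]
            have := ((hη1 t).hasDerivWithinAt (s := Icc 0 1)).derivWithin hu
            rw [← this, ← fderivWithin_derivWithin]
            rfl
          have e3 : mfderivWithin 𝓘(ℝ, ℝ) 𝓘(ℝ, E) (φ.symm ∘ η) (Icc 0 1) t 1 =
              (trivializationAt E (TangentSpace 𝓘(ℝ, E)) x).symmL ℝ (φ.symm (η t))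
                (φ y - φ x) := by
            rw [TangentBundle.symmL_trivializationAt hsrc, ← hφ, φ.right_inv (hmaps t ht), ← e2]
            exact congr($e1 1)
          rw [e3, ← ofReal_norm]
          exact ENNReal.ofReal_le_ofReal ((h _ (hη t ht)).2 _)
      _ = ENNReal.ofReal (k * ‖tangentChart E x y‖) := by simp
  have hfin := hlen.trans hbound
  rw [← ofReal_dist_eq] at hfin
  exact (ENNReal.ofReal_le_ofReal_iff (by positivity)).1 hfin

variable [IsContMDiffRiemannianBundle 𝓘(ℝ, E) 1 E (fun x : M => TangentSpace 𝓘(ℝ, E) x)]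

variable (E) in
/-- In the chart at `x`, distances agree with those of the Euclidean space `T_x M` up to relative
errors of first order. This is where the differentiability of the Riemannian metric enters. -/
theorem exists_tangentChart_bounds (x : M) : ∃ C ρ₀ : ℝ, 0 ≤ C ∧ 0 < ρ₀ ∧
    (∀ ρ < ρ₀, ∀ p q, dist x p ≤ ρ → dist x q ≤ ρ →
      ‖tangentChart E x p - tangentChart E x q‖ ≤ (1 + C * ρ) * dist p q) ∧
    (∀ p, dist x p < ρ₀ → (1 - C * dist x p) * dist x p ≤ ‖tangentChart E x p‖) := by
  obtain ⟨C₀, hC₀, hev⟩ := exists_symmL_bounds E E (fun x : M => TangentSpace 𝓘(ℝ, E) x) x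
  have hxx : x ∈ (trivializationAt E (TangentSpace 𝓘(ℝ, E)) x).baseSet :=
    FiberBundle.mem_baseSet_trivializationAt' x
  set S : E →L[ℝ] TangentSpace 𝓘(ℝ, E) x :=
    (trivializationAt E (TangentSpace 𝓘(ℝ, E)) x).symmL ℝ x with hS
  set φ := extChartAt 𝓘(ℝ, E) x with hφ
  let G := (trivializationAt E (TangentSpace 𝓘(ℝ, E)) x).continuousLinearEquivAt ℝ x hxx
  set K := ‖(G : TangentSpace 𝓘(ℝ, E) x →L[ℝ] E)‖ with hK
  have hG : ∀ w : E, ‖w‖ ≤ K * ‖S w‖ := by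
    intro w
    have h1 := (G : TangentSpace 𝓘(ℝ, E) x →L[ℝ] E).le_opNorm (G.symm w)
    have h2 : (G : TangentSpace 𝓘(ℝ, E) x →L[ℝ] E) (G.symm w) = w := G.apply_symm_apply w
    have h3 : G.symm w = S w :=
      congrFun (Bundle.Trivialization.symm_continuousLinearEquivAt_eq _ hxx) w
    rwa [h2, h3] at h1
  have hK0 : 0 ≤ K := ContinuousLinearMap.opNorm_nonneg _
  set C := C₀ * K with hC
  have hC0 : 0 ≤ C := by positivity
  have hψ : ∀ y, tangentChart E x y = S (φ y - φ x) := fun _ => rfl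
  have hcont : Filter.Tendsto (fun y => C * ‖tangentChart E x y‖) (𝓝 x) (𝓝 0) := by
    have h1 : ContinuousAt (fun y => C * ‖S (φ y - φ x)‖) x :=
      ((S.continuous.continuousAt.comp
        ((continuousAt_extChartAt (I := 𝓘(ℝ, E)) x).sub continuousAt_const)).norm).const_mul C
    simpa [ContinuousAt, hψ] using h1
  -- `U` is a neighbourhood on which all first order estimates hold
  have hU : ∀ᶠ y in 𝓝 x, y ∈ (chartAt E x).source ∧ C * ‖tangentChart E x y‖ ≤ 1 ∧ ∀ w : E,
      ‖S w‖ ≤ (1 + C * ‖tangentChart E x y‖) *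
        ‖(trivializationAt E (TangentSpace 𝓘(ℝ, E)) x).symmL ℝ y w‖ ∧
      ‖(trivializationAt E (TangentSpace 𝓘(ℝ, E)) x).symmL ℝ y w‖ ≤
        (1 + C * ‖tangentChart E x y‖) * ‖S w‖ := by
    filter_upwards [hev, chart_source_mem_nhds E x, hcont.eventually_le_const zero_lt_one]
      with y h1 h2 h3
    refine ⟨h2, h3, fun w => ?_⟩
    have h4 : C₀ * ‖φ y - φ x‖ ≤ C * ‖tangentChart E x y‖ := by
      rw [hC, mul_assoc, hψ]
      gcongr
      exact hG _
    exact ⟨(h1 w).1.trans (by gcongr), (h1 w).2.trans (by gcongr)⟩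
  obtain ⟨r, hr, hrU⟩ := Metric.eventually_nhds_iff.1 hU
  have hsource : ∀ y, dist x y < r → y ∈ (chartAt E x).source := fun y hy =>
    (hrU (by rwa [dist_comm])).1
  have hchart : ∀ y, dist x y < r → ∀ v : TangentSpace 𝓘(ℝ, E) y,
      ‖S (mfderiv 𝓘(ℝ, E) 𝓘(ℝ, E) φ y v)‖ ≤ (1 + C * ‖tangentChart E x y‖) * ‖v‖ := by
    intro y hy v
    obtain ⟨h1, -, h2⟩ := hrU (y := y) (by rwa [dist_comm])
    refine (h2 _).1.trans_eq ?_
    congr 2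
    have hb : y ∈ (trivializationAt E (TangentSpace 𝓘(ℝ, E)) x).baseSet := by simpa using h1
    rw [hφ, ← TangentBundle.continuousLinearMapAt_trivializationAt h1]
    exact (trivializationAt E (TangentSpace 𝓘(ℝ, E)) x).symmL_continuousLinearMapAt hb v
  have hzero : tangentChart E x x = 0 := by rw [hψ, sub_self, map_zero]
  -- a first crude estimate: the chart is locally Lipschitz
  have hcrude : ∀ y, dist x y < r / 4 → ‖tangentChart E x y‖ ≤ 2 * dist x y := by
    intro y hy
    have := norm_tangentChart_sub_le (ρ := r / 4) (x := x) (k := 2) (by norm_num)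
      (fun z hz => ⟨hsource z (by linarith), fun v => (hchart z (by linarith) v).trans (by
        have := (hrU (y := z) (by rw [dist_comm]; linarith)).2.1
        gcongr
        linarith)⟩) (p := y) (q := x) hy (by rw [dist_self]; linarith)
    rwa [hzero, sub_zero, dist_comm y x] at this
  -- all `z` with `S (z - φ x)` small are in the image of `U`
  obtain ⟨δ, hδ, hδU⟩ : ∃ δ > 0, ∀ z : E, ‖S (z - φ x)‖ < δ →
      z ∈ φ.target ∧ dist (φ.symm z) x < r := by
    have h1 : ∀ᶠ z in 𝓝 (φ x), z ∈ φ.target ∧ dist (φ.symm z) x < r := by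
      refine Filter.Eventually.and (extChartAt_target_mem_nhds x) ?_
      have h2 : ContinuousAt φ.symm (φ x) := continuousAt_extChartAt_symm x
      have h3 : φ.symm (φ x) = x := extChartAt_to_inv x
      rw [ContinuousAt, h3] at h2
      exact h2.eventually (Metric.ball_mem_nhds x hr)
    obtain ⟨δ, hδ, h4⟩ := Metric.eventually_nhds_iff.1 h1
    refine ⟨δ / (K + 1), by positivity, fun z hz => h4 ?_⟩
    rw [dist_eq_norm]
    rw [lt_div_iff₀ (by positivity)] at hz
    refine (hG _).trans_lt (lt_of_le_of_lt ?_ hz)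
    rw [mul_comm]
    gcongr
    linarith
  refine ⟨16 * C, min (r / 32) (δ / 2), by positivity, by positivity, ?_, ?_⟩
  · intro ρ hρ p q hp hq
    rcases (dist_nonneg.trans hp).eq_or_lt with h0 | h0
    · have e1 : x = p := dist_le_zero.1 (by rwa [h0])
      have e2 : x = q := dist_le_zero.1 (by rwa [h0])
      rw [← e1, ← e2]
      simp
    · have hρ' := (lt_min_iff.1 hρ).1
      refine norm_tangentChart_sub_le (ρ := 2 * ρ) (by positivity) (fun z hz => ?_)
        (by linarith) (by linarith)
      refine ⟨hsource z (by linarith), fun v => (hchart z (by linarith) v).trans ?_⟩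
      have h1 := hcrude z (by linarith)
      have h2 : C * ‖tangentChart E x z‖ ≤ 16 * C * ρ := by
        calc C * ‖tangentChart E x z‖ ≤ C * (16 * ρ) := by gcongr; linarith
          _ = _ := by ring
      gcongr
  · intro p hp
    obtain ⟨hp1, hp2⟩ := lt_min_iff.1 hp
    have h1 := hcrude p (by linarith)
    set m := ‖tangentChart E x p‖ with hm
    have hm0 : 0 ≤ m := norm_nonneg _
    have hD : 0 ≤ dist x p := dist_nonneg
    have h2 : dist x p ≤ (1 + C * m) * m := by
      refine dist_le_mul_norm_tangentChart (by positivity) (hsource p (by linarith)) ?_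
      intro z hz
      obtain ⟨h3, h4⟩ := hδU z (hz.trans_lt (by linarith))
      refine ⟨h3, fun w => ((hrU h4).2.2 w).2.trans ?_⟩
      have h5 : ‖tangentChart E x (φ.symm z)‖ ≤ m := by
        rw [hψ, φ.right_inv h3]
        exact hz
      gcongr
    have h6 : 0 ≤ C * dist x p * dist x p := by positivity
    rcases le_total (dist x p) m with h | h
    · linarith
    · have : C * m * m ≤ C * dist x p * dist x p := by gcongr
      linarith

/-- A curve that realizes distances near its starting point with constant speed `c` is
differentiable there, and its initial velocity has Riemannian norm `c`. -/
theorem mdifferentiableWithinAt_of_dist_eq [FiniteDimensional ℝ E] {γ : ℝ → M} {c ε : ℝ}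
    (hc : 0 ≤ c) (hε : 0 < ε)
    (h : ∀ a ∈ Icc (0 : ℝ) 1 ∩ Ioo (0 - ε) (0 + ε), ∀ b ∈ Icc (0 : ℝ) 1 ∩ Ioo (0 - ε) (0 + ε),
      dist (γ a) (γ b) = c * |a - b|) :
    MDifferentiableWithinAt 𝓘(ℝ, ℝ) 𝓘(ℝ, E) γ (Icc 0 1) 0 ∧
    ‖(mfderivWithin 𝓘(ℝ, ℝ) 𝓘(ℝ, E) γ (Icc 0 1) 0 1 : TangentSpace 𝓘(ℝ, E) (γ 0))‖ = c := by
  obtain ⟨C, ρ₀, hC, hρ₀, hup, hlow⟩ := exists_tangentChart_bounds E (γ 0)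
  have hxx : γ 0 ∈ (trivializationAt E (TangentSpace 𝓘(ℝ, E)) (γ 0)).baseSet :=
    FiberBundle.mem_baseSet_trivializationAt' (γ 0)
  set S : E →L[ℝ] TangentSpace 𝓘(ℝ, E) (γ 0) :=
    (trivializationAt E (TangentSpace 𝓘(ℝ, E)) (γ 0)).symmL ℝ (γ 0) with hS
  set T : TangentSpace 𝓘(ℝ, E) (γ 0) →L[ℝ] E :=
    (trivializationAt E (TangentSpace 𝓘(ℝ, E)) (γ 0)).continuousLinearMapAt ℝ (γ 0) with hT
  set φ := extChartAt 𝓘(ℝ, E) (γ 0) with hφ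
  have hTS : ∀ w, T (S w) = w := fun w =>
    (trivializationAt E (TangentSpace 𝓘(ℝ, E)) (γ 0)).continuousLinearMapAt_symmL hxx w
  have hST : ∀ v, S (T v) = v := fun v =>
    (trivializationAt E (TangentSpace 𝓘(ℝ, E)) (γ 0)).symmL_continuousLinearMapAt hxx v
  set ε' := min (min ε 1) (ρ₀ / (c + 1)) with hε'
  have hε'0 : 0 < ε' := by positivity
  have hmem : ∀ t, 0 ≤ t → t < ε' → t ∈ Icc (0 : ℝ) 1 ∩ Ioo (0 - ε) (0 + ε) ∧ c * t < ρ₀ := by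
    intro t h0 ht
    obtain ⟨h1, h2⟩ := lt_min_iff.1 ht
    obtain ⟨h3, h4⟩ := lt_min_iff.1 h1
    refine ⟨⟨⟨h0, h4.le⟩, by linarith, by linarith⟩, ?_⟩
    rw [lt_div_iff₀ (by positivity)] at h2
    linarith
  have hdist : ∀ s t, 0 ≤ s → s ≤ t → t < ε' → dist (γ s) (γ t) = c * (t - s) := by
    intro s t h0 hst ht
    rw [h s (hmem s h0 (by linarith)).1 t (hmem t (by linarith) ht).1, abs_sub_comm,
      abs_of_nonneg (by linarith)]
  have hdist0 : ∀ t, 0 ≤ t → t < ε' → dist (γ 0) (γ t) = c * t := by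
    intro t h0 ht
    rw [hdist 0 t le_rfl h0 ht, sub_zero]
  have : FiniteDimensional ℝ (TangentSpace 𝓘(ℝ, E) (γ 0)) := inferInstanceAs (FiniteDimensional ℝ E)
  have : CompleteSpace (TangentSpace 𝓘(ℝ, E) (γ 0)) := FiniteDimensional.complete ℝ _
  obtain ⟨v, hv, hvc⟩ := exists_hasDerivWithinAt_of_chord_bounds (C := C * c)
    (z := fun t => tangentChart E (γ 0) (γ t)) hc (by positivity) hε'0 (by
      intro s t h0 hst ht
      have h1 := hup (c * t) (hmem t (h0.trans hst) ht).2 (γ s) (γ t)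
        (by rw [hdist0 s h0 (by linarith)]; gcongr) (by rw [hdist0 t (h0.trans hst) ht])
      rwa [hdist s t h0 hst ht, ← mul_assoc C] at h1) (by simp [tangentChart]) (by
      intro t h0 ht
      have h1 := hlow (γ t) (by rw [hdist0 t h0 ht]; exact (hmem t h0 ht).2)
      rwa [hdist0 t h0 ht, ← mul_assoc C] at h1)
  have hv' : HasDerivWithinAt (fun t => φ (γ t)) (T v) (Icc 0 1) 0 := by
    have h0 := hv.mono (Icc_subset_Ici_self : Icc (0 : ℝ) 1 ⊆ Ici 0)
    have h1 := (T.hasFDerivAt.comp_hasDerivWithinAt (0 : ℝ) h0).const_add (φ (γ 0))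
    have h2 : (fun t => φ (γ 0) + (T ∘ fun t => tangentChart E (γ 0) (γ t)) t) =
        fun t => φ (γ t) := by
      funext t
      have : T (tangentChart E (γ 0) (γ t)) = φ (γ t) - φ (γ 0) := hTS _
      simp [this]
    rwa [h2] at h1
  have hmd : MDifferentiableWithinAt 𝓘(ℝ, ℝ) 𝓘(ℝ, E) γ (Icc 0 1) 0 := by
    rw [mdifferentiableWithinAt_iff]
    constructor
    · rw [Metric.continuousWithinAt_iff]
      intro η hη
      refine ⟨min ε' (η / (c + 1)), by positivity, fun t ht htd => ?_⟩
      rw [Real.dist_eq, sub_zero, abs_of_nonneg ht.1] at htd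
      obtain ⟨h1, h2⟩ := lt_min_iff.1 htd
      rw [dist_comm, hdist0 t ht.1 h1]
      rw [lt_div_iff₀ (by positivity)] at h2
      linarith [ht.1]
    · simp only [extChartAt_model_space_eq_id, PartialEquiv.refl_symm,
        PartialEquiv.refl_coe, Function.comp_def, id, modelWithCornersSelf_coe,
        range_id, inter_univ]
      exact hv'.differentiableWithinAt
  refine ⟨hmd, ?_⟩
  have e1 : mfderivWithin 𝓘(ℝ, ℝ) 𝓘(ℝ, E) (φ ∘ γ) (Icc 0 1) 0 =
      (mfderiv 𝓘(ℝ, E) 𝓘(ℝ, E) φ (γ 0)) ∘L (mfderivWithin 𝓘(ℝ, ℝ) 𝓘(ℝ, E) γ (Icc 0 1) 0) := by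
    apply mfderiv_comp_mfderivWithin
    · exact mdifferentiableAt_extChartAt (mem_chart_source E (γ 0))
    · exact hmd
    · rw [uniqueMDiffWithinAt_iff_uniqueDiffWithinAt]
      exact uniqueDiffOn_Icc zero_lt_one 0 ⟨le_rfl, zero_le_one⟩
  have e2 : T v = T (mfderivWithin 𝓘(ℝ, ℝ) 𝓘(ℝ, E) γ (Icc 0 1) 0 1) := by
    rw [hT, TangentBundle.continuousLinearMapAt_trivializationAt (mem_chart_source E (γ 0)), ← hφ]
    have h1 : mfderivWithin 𝓘(ℝ, ℝ) 𝓘(ℝ, E) (φ ∘ γ) (Icc 0 1) 0 1 = T v := by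
      rw [mfderivWithin_eq_fderivWithin]
      have := hv'.derivWithin (uniqueDiffOn_Icc zero_lt_one 0 ⟨le_rfl, zero_le_one⟩)
      rw [← this, ← fderivWithin_derivWithin]
      rfl
    rw [hT, TangentBundle.continuousLinearMapAt_trivializationAt (mem_chart_source E (γ 0)), ← hφ]
      at h1
    rw [← h1]
    exact congr($e1 1)
  -- `S` is a left inverse of `T`, so the velocity is the derivative `v` of the curve in the chart
  have e3 := congrArg S e2
  rw [hST, hST] at e3
  rw [← hvc, e3]

end Coordinates

/-! ### Complete locally compact length spaces -/

section Length

variable {M : Type*} [MetricSpace M]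

variable (M) in
/-- Any two points of `M` are joined by continuous curves that almost realize the distance. Instead
of the length of the curve, its inscribed polygons with two intermediate points are bounded. -/
def HasAlmostGeodesics : Prop :=
  ∀ x y : M, ∀ ε > 0, ∃ γ : ℝ → M, Continuous γ ∧ γ 0 = x ∧ γ 1 = y ∧
    ∀ a b, 0 ≤ a → a ≤ b → b ≤ 1 →
      dist x (γ a) + dist (γ a) (γ b) + dist (γ b) y ≤ dist x y + ε

/-- Parametrizing an almost geodesic by the distance to its starting point. -/
theorem HasAlmostGeodesics.exists_param (h : HasAlmostGeodesics M) (x y : M) {ε : ℝ}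
    (hε : 0 < ε) : ∃ z : ℝ → M, (∀ s ∈ Icc (0 : ℝ) 1, dist x (z s) = s * dist x y) ∧
      ∀ s t, 0 ≤ s → s ≤ t → t ≤ 1 →
        dist x (z s) + dist (z s) (z t) + dist (z t) y ≤ dist x y + ε := by
  obtain ⟨γ, hγ, h0, h1, hlen⟩ := h x y ε hε
  -- the first time at which the distance to `x` reaches `s * dist x y`
  have hτ : ∀ s : ℝ, s ∈ Icc (0 : ℝ) 1 →
      ∃ τ, IsLeast {τ | τ ∈ Icc (0 : ℝ) 1 ∧ s * dist x y ≤ dist x (γ τ)} τ := by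
    intro s hs
    have hcl : IsClosed {τ | s * dist x y ≤ dist x (γ τ)} :=
      isClosed_le continuous_const (continuous_const.dist hγ)
    refine (isCompact_Icc.inter_right hcl).exists_isLeast ⟨1, ⟨zero_le_one, le_rfl⟩, ?_⟩
    rw [mem_ofPred_eq, h1]
    exact mul_le_of_le_one_left dist_nonneg hs.2
  choose! τ hτ using hτ
  have hval : ∀ s ∈ Icc (0 : ℝ) 1, dist x (γ (τ s)) = s * dist x y := by
    intro s hs
    obtain ⟨⟨h2, h3⟩, h4⟩ := hτ s hs
    refine le_antisymm ?_ h3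
    by_contra! hlt
    have hcont : Continuous fun t => dist x (γ t) := continuous_const.dist hγ
    have hv : s * dist x y ∈ Icc (dist x (γ 0)) (dist x (γ (τ s))) := by
      rw [h0, dist_self]
      exact ⟨mul_nonneg hs.1 dist_nonneg, h3⟩
    obtain ⟨σ, hσ, hσv⟩ := intermediate_value_Icc h2.1 hcont.continuousOn hv
    have h5 : τ s ≤ σ := h4 ⟨⟨hσ.1, hσ.2.trans h2.2⟩, hσv.ge⟩
    have h6 : σ = τ s := le_antisymm hσ.2 h5
    rw [h6] at hσv
    exact absurd hσv hlt.ne'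
  refine ⟨γ ∘ τ, hval, fun s t hs hst ht => ?_⟩
  have hs' : s ∈ Icc (0 : ℝ) 1 := ⟨hs, hst.trans ht⟩
  have ht' : t ∈ Icc (0 : ℝ) 1 := ⟨hs.trans hst, ht⟩
  refine hlen _ _ (hτ s hs').1.1.1 ?_ (hτ t ht').1.1.2
  exact (hτ s hs').2 ⟨(hτ t ht').1.1, le_trans (by gcongr) (hτ t ht').1.2⟩

/-- The Hopf–Rinow–Cohn-Vossen theorem: bounded closed sets are compact. The compactness of balls
about `x` passes to the limit of the radii by total boundedness, and to slightly larger radii by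
local compactness. -/
theorem HasAlmostGeodesics.properSpace [CompleteSpace M] [LocallyCompactSpace M]
    (h : HasAlmostGeodesics M) : ProperSpace M := by
  have hstep : ∀ (x y : M) (r ε : ℝ), 0 ≤ r → r ≤ dist x y → 0 < ε →
      ∃ z, dist x z = r ∧ dist z y ≤ dist x y - r + ε := by
    intro x y r ε hr hry hε
    rcases (dist_nonneg (x := x) (y := y)).eq_or_lt with h0 | h0
    · have : r = 0 := le_antisymm (by linarith) hr
      exact ⟨x, by rw [dist_self, this], by linarith⟩
    · obtain ⟨z, hz1, hz2⟩ := h.exists_param x y hε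
      have hmem : r / dist x y ∈ Icc (0 : ℝ) 1 := ⟨by positivity, by rwa [div_le_one h0]⟩
      have e1 : dist x (z (r / dist x y)) = r := by
        rw [hz1 _ hmem]; field_simp
      refine ⟨z (r / dist x y), e1, ?_⟩
      have := hz2 _ _ hmem.1 le_rfl hmem.2
      rw [dist_self, e1] at this
      linarith
  refine ⟨fun x r₁ => ?_⟩
  by_contra hr₁
  set S := {r : ℝ | 0 ≤ r ∧ IsCompact (Metric.closedBall x r)} with hS
  have h0S : (0 : ℝ) ∈ S := ⟨le_rfl, by simp⟩
  have hbdd : BddAbove S := by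
    refine ⟨r₁, fun r hr => ?_⟩
    by_contra! hlt
    exact hr₁ (hr.2.of_isClosed_subset Metric.isClosed_closedBall
      (Metric.closedBall_subset_closedBall hlt.le))
  set ρ := sSup S with hρ
  have hρ0 : 0 ≤ ρ := le_csSup hbdd h0S
  -- the supremum of the radii of compact balls is attained
  have hρS : IsCompact (Metric.closedBall x ρ) := by
    refine isCompact_iff_totallyBounded_isComplete.2
      ⟨?_, Metric.isClosed_closedBall.isComplete⟩
    rw [Metric.totallyBounded_iff]
    intro ε hε
    obtain ⟨r, hrS, hr⟩ := exists_lt_of_lt_csSup ⟨0, h0S⟩ (show ρ - ε / 4 < sSup S by linarith)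
    obtain ⟨t, ht, htc⟩ := Metric.totallyBounded_iff.1 hrS.2.totallyBounded (ε / 2) (by linarith)
    refine ⟨t, ht, fun y hy => ?_⟩
    rw [Metric.mem_closedBall, dist_comm] at hy
    obtain ⟨z, hz1, hz2⟩ : ∃ z, dist x z ≤ r ∧ dist z y < ε / 2 := by
      rcases le_total (dist x y) r with h1 | h1
      · exact ⟨y, h1, by rw [dist_self]; linarith⟩
      · obtain ⟨z, hz1, hz2⟩ := hstep x y r (ε / 8) hrS.1 h1 (by linarith)
        exact ⟨z, hz1.le, by linarith⟩
    have hzc := htc (show z ∈ Metric.closedBall x r by rwa [Metric.mem_closedBall, dist_comm])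
    simp only [mem_iUnion, Metric.mem_ball] at hzc ⊢
    obtain ⟨i, hi, hzi⟩ := hzc
    refine ⟨i, hi, ?_⟩
    linarith [dist_triangle y z i, dist_comm y z]
  -- by local compactness, a slightly larger ball is compact as well
  obtain ⟨δ, hδ, hδc⟩ := hρS.exists_isCompact_cthickening
  have hδS : ρ + δ / 2 ∈ S := by
    refine ⟨by linarith, hδc.of_isClosed_subset Metric.isClosed_closedBall fun y hy => ?_⟩
    rw [Metric.mem_closedBall, dist_comm] at hy
    obtain ⟨z, hz1, hz2⟩ : ∃ z, dist x z ≤ ρ ∧ dist z y ≤ δ := by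
      rcases le_total (dist x y) ρ with h1 | h1
      · exact ⟨y, h1, by rw [dist_self]; linarith⟩
      · obtain ⟨z, hz1, hz2⟩ := hstep x y ρ (δ / 2) hρ0 h1 (by linarith)
        exact ⟨z, hz1.le, by linarith⟩
    exact Metric.mem_cthickening_of_dist_le y z δ _
      (by rwa [Metric.mem_closedBall, dist_comm]) (by rwa [dist_comm])
  linarith [le_csSup hbdd hδS]

/-- In a proper space, almost geodesics converge to geodesics along an ultrafilter. -/
theorem HasAlmostGeodesics.exists_geodesic [ProperSpace M] (h : HasAlmostGeodesics M) (x y : M) :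
    ∃ γ : ℝ → M, γ 0 = x ∧ γ 1 = y ∧
      ∀ s ∈ Icc (0 : ℝ) 1, ∀ t ∈ Icc (0 : ℝ) 1, dist (γ s) (γ t) = dist x y * |s - t| := by
  have hpos : ∀ n : ℕ, (0 : ℝ) < 1 / (n + 1) := fun n => by positivity
  choose z hz1 hz2 using fun n : ℕ => h.exists_param x y (hpos n)
  have hlim : ∀ s : ℝ, s ∈ Icc (0 : ℝ) 1 →
      ∃ p, Filter.Tendsto (fun n => z n s) (Filter.hyperfilter ℕ : Filter ℕ) (𝓝 p) := by
    intro s hs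
    have hK := isCompact_closedBall x (dist x y)
    obtain ⟨p, -, hp⟩ := hK.ultrafilter_le_nhds ((Filter.hyperfilter ℕ).map fun n => z n s) (by
      rw [Filter.le_principal_iff]
      refine Filter.Eventually.of_forall (f := (Filter.hyperfilter ℕ : Filter ℕ)) fun n => ?_
      rw [Metric.mem_closedBall, dist_comm, hz1 n s hs]
      exact mul_le_of_le_one_left dist_nonneg hs.2)
    exact ⟨p, hp⟩
  have : Nonempty M := ⟨x⟩
  choose! γ hγ using hlim
  have hε : Filter.Tendsto (fun n : ℕ => (1 : ℝ) / (n + 1)) (Filter.hyperfilter ℕ : Filter ℕ)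
      (𝓝 0) :=
    (tendsto_one_div_add_atTop_nhds_zero_nat (𝕜 := ℝ)).mono_left
      (Nat.hyperfilter_le_atTop)
  have hx : ∀ s ∈ Icc (0 : ℝ) 1, dist x (γ s) = s * dist x y := by
    intro s hs
    refine tendsto_nhds_unique (tendsto_const_nhds.dist (hγ s hs)) ?_
    simp only [hz1 _ s hs]
    exact tendsto_const_nhds
  have hsum : ∀ s t, 0 ≤ s → s ≤ t → t ≤ 1 →
      dist x (γ s) + dist (γ s) (γ t) + dist (γ t) y ≤ dist x y := by
    intro s t hs hst ht
    have l1 := hγ s ⟨hs, hst.trans ht⟩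
    have l2 := hγ t ⟨hs.trans hst, ht⟩
    have := le_of_tendsto_of_tendsto'
      (((tendsto_const_nhds (x := x)).dist l1).add (l1.dist l2) |>.add
        (l2.dist (tendsto_const_nhds (x := y))))
      (hε.const_add (dist x y)) (fun n => hz2 n s t hs hst ht)
    simpa using this
  have hdist : ∀ s t, 0 ≤ s → s ≤ t → t ≤ 1 → dist (γ s) (γ t) = dist x y * (t - s) := by
    intro s t hs hst ht
    have e1 := hx s ⟨hs, hst.trans ht⟩
    have e2 := hx t ⟨hs.trans hst, ht⟩
    have e3 := hsum s t hs hst ht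
    have e4 := dist_triangle x (γ t) y
    have e5 := dist_triangle x (γ s) (γ t)
    refine le_antisymm ?_ ?_ <;> nlinarith
  refine ⟨γ, ?_, ?_, fun s hs t ht => ?_⟩
  · have := hx 0 ⟨le_rfl, zero_le_one⟩
    rw [zero_mul] at this
    exact (dist_eq_zero.1 this).symm
  · have e1 := hx 1 ⟨zero_le_one, le_rfl⟩
    have e2 := hsum 1 1 zero_le_one le_rfl le_rfl
    rw [dist_self, e1] at e2
    exact dist_le_zero.1 (by linarith)
  · rcases le_total s t with hst | hst
    · rw [hdist s t hs.1 hst ht.2, abs_sub_comm, abs_of_nonneg (by linarith)]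
    · rw [dist_comm, hdist t s ht.1 hst hs.2, abs_of_nonneg (by linarith)]

end Length

section Riemannian

variable (E : Type*) [NormedAddCommGroup E] [NormedSpace ℝ E]
  {M : Type*} [MetricSpace M] [ChartedSpace E M]
  [RiemannianBundle (fun x : M => TangentSpace 𝓘(ℝ, E) x)]
  [IsRiemannianManifold 𝓘(ℝ, E) M]

include E in
variable (M) in
/-- Curves whose length is close to the distance of their endpoints are almost geodesics. -/
theorem hasAlmostGeodesics_of_isRiemannianManifold : HasAlmostGeodesics M := by
  intro x y ε hε
  have hr0 : 0 < dist x y + ε := by positivity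
  have hr : riemannianEDist 𝓘(ℝ, E) x y < ENNReal.ofReal (dist x y + ε) := by
    rw [← ofReal_dist_eq]
    exact (ENNReal.ofReal_lt_ofReal_iff hr0).2 (by linarith)
  obtain ⟨γ, hγ0, hγ1, hγ, hlen, -⟩ :=
    exists_lt_locally_constant_of_riemannianEDist_lt hr zero_lt_one
  refine ⟨γ, hγ.continuous, hγ0, hγ1, fun a b ha hab hb => ?_⟩
  have key : ∀ s t : ℝ, s ≤ t → ENNReal.ofReal (dist (γ s) (γ t)) ≤ pathELength 𝓘(ℝ, E) γ s t := by
    intro s t hst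
    rw [ofReal_dist_eq (E := E)]
    exact riemannianEDist_le_pathELength hγ.contMDiffOn rfl rfl hst
  have h1 := key 0 a ha
  have h2 := key a b hab
  have h3 := key b 1 hb
  rw [hγ0] at h1
  rw [hγ1] at h3
  have h4 := add_le_add (add_le_add h1 h2) h3
  rw [pathELength_add ha hab, pathELength_add (ha.trans hab) hb,
    ← ENNReal.ofReal_add dist_nonneg dist_nonneg,
    ← ENNReal.ofReal_add (by positivity) dist_nonneg] at h4
  exact (ENNReal.ofReal_le_ofReal_iff hr0.le).1 (h4.trans hlen.le)

end Riemannian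

/-! ### Initial velocities of geodesics -/

section ExpInv

/-- The endpoints of a geodesic of speed `c` have distance at most `c`. -/
theorem dist_le_of_locally_dist_eq {M : Type*} [MetricSpace M] {γ : ℝ → M} {c : ℝ} (hc : 0 ≤ c)
    (h : ∀ t ∈ Icc (0 : ℝ) 1, ∃ ε > 0,
      ∀ a ∈ Icc (0 : ℝ) 1 ∩ Ioo (t - ε) (t + ε), ∀ b ∈ Icc (0 : ℝ) 1 ∩ Ioo (t - ε) (t + ε),
        dist (γ a) (γ b) = c * |a - b|) : dist (γ 0) (γ 1) ≤ c := by
  set A := {t : ℝ | dist (γ 0) (γ t) ≤ c * t} with hA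
  have hcont : ContinuousOn γ (Icc 0 1) := by
    intro t ht
    obtain ⟨ε, hε, hd⟩ := h t ht
    rw [Metric.continuousWithinAt_iff]
    intro η hη
    refine ⟨min ε (η / (c + 1)), by positivity, fun {s} hs hst => ?_⟩
    obtain ⟨h1, h2⟩ := lt_min_iff.1 hst
    rw [Real.dist_eq] at h1 h2
    obtain ⟨h3, h4⟩ := abs_lt.1 h1
    rw [hd s ⟨hs, by linarith, by linarith⟩ t ⟨ht, by linarith, by linarith⟩]
    rw [lt_div_iff₀ (by positivity)] at h2
    linarith [abs_nonneg (s - t)]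
  have hclosed : IsClosed (A ∩ Icc 0 1) := by
    have h1 : ContinuousOn (fun t => (dist (γ 0) (γ t), c * t)) (Icc 0 1) :=
      ((continuous_const.dist continuous_id).comp_continuousOn hcont).prodMk (by fun_prop)
    have h2 := h1.preimage_isClosed_of_isClosed isClosed_Icc
      (isClosed_le continuous_fst continuous_snd)
    rwa [inter_comm] at h2
  have hsub : Icc (0 : ℝ) 1 ⊆ A := by
    refine hclosed.Icc_subset_of_forall_mem_nhdsWithin (by simp [hA]) ?_
    rintro t ⟨ht, ht'⟩
    obtain ⟨ε, hε, hd⟩ := h t (Ico_subset_Icc_self ht')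
    have hIoo : Ioo t (min 1 (t + ε)) ∈ 𝓝[>] t :=
      Ioo_mem_nhdsGT (lt_min ht'.2 (by linarith))
    filter_upwards [hIoo] with s hs
    obtain ⟨h1, h2⟩ := lt_min_iff.1 hs.2
    have h3 := hd t ⟨Ico_subset_Icc_self ht', by linarith, by linarith⟩ s
      ⟨⟨ht'.1.trans hs.1.le, h1.le⟩, by linarith [hs.1], h2⟩
    rw [abs_sub_comm, abs_of_nonneg (by linarith [hs.1])] at h3
    have h4 : dist (γ 0) (γ t) ≤ c * t := ht
    change dist (γ 0) (γ s) ≤ c * s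
    linarith [dist_triangle (γ 0) (γ t) (γ s)]
  have : dist (γ 0) (γ 1) ≤ c * 1 := hsub ⟨zero_le_one, le_rfl⟩
  linarith

variable {d : ℕ} {M : Type*} [MetricSpace M]
    [ChartedSpace (EuclideanSpace ℝ (Fin d)) M] [IsManifold (𝓡 d) ∞ M]
    [RiemannianBundle (fun x : M => TangentSpace (𝓡 d) x)]

variable [IsContMDiffRiemannianBundle (𝓡 d) ∞ (EuclideanSpace ℝ (Fin d))
    (fun x : M => TangentSpace (𝓡 d) x)]

theorem isContMDiffRiemannianBundle_one : IsContMDiffRiemannianBundle (𝓡 d) 1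
    (EuclideanSpace ℝ (Fin d)) (fun x : M => TangentSpace (𝓡 d) x) :=
  IsContMDiffRiemannianBundle.of_le (n := ∞) (by norm_cast)

variable [IsRiemannianManifold (𝓡 d) M]

/-- Initial velocities of geodesics from `x` to `y` are at least as long as the distance. -/
theorem dist_le_norm_of_mem_expInv {x y : M} {v : TangentBundle (𝓡 d) M} (hv : v ∈ expInv x y) :
    dist x y ≤ ‖v.2‖ := by
  have := isContMDiffRiemannianBundle_one (d := d) (M := M)
  obtain ⟨γ, ⟨c, hc, hγ⟩, h0, h1, -, rfl⟩ := hv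
  obtain ⟨ε, hε, hloc⟩ := hγ 0 ⟨le_rfl, zero_le_one⟩
  rw [← h0, ← h1]
  refine (dist_le_of_locally_dist_eq hc hγ).trans_eq ?_
  exact (mdifferentiableWithinAt_of_dist_eq (E := EuclideanSpace ℝ (Fin d)) hc hε hloc).2.symm

variable (d) in
/-- On a complete manifold some geodesic from `x` to `y` realizes the distance. -/
theorem exists_mem_expInv_norm_eq_dist [ProperSpace M] (x y : M) :
    ∃ v ∈ expInv (d := d) x y, ‖v.2‖ = dist x y := by
  have := isContMDiffRiemannianBundle_one (d := d) (M := M)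
  obtain ⟨γ, h0, h1, hγ⟩ := (hasAlmostGeodesics_of_isRiemannianManifold
    (EuclideanSpace ℝ (Fin d)) M).exists_geodesic x y
  have hloc : ∀ t : ℝ, ∀ a ∈ Icc (0 : ℝ) 1 ∩ Ioo (t - 1) (t + 1),
      ∀ b ∈ Icc (0 : ℝ) 1 ∩ Ioo (t - 1) (t + 1), dist (γ a) (γ b) = dist x y * |a - b| :=
    fun t a ha b hb => hγ a ha.1 b hb.1
  have hd := mdifferentiableWithinAt_of_dist_eq (E := EuclideanSpace ℝ (Fin d)) (γ := γ)
    dist_nonneg zero_lt_one (hloc 0)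
  exact ⟨_, ⟨γ, ⟨dist x y, dist_nonneg, fun t _ => ⟨1, one_pos, hloc t⟩⟩, h0, h1, hd.1, rfl⟩, hd.2⟩

end ExpInv

/-! ### Intrinsic means in proper metric spaces -/

section Mean

variable {M : Type*} [MetricSpace M] {ι : Type*} [Fintype ι]

/-- The factor by which a ball containing the data has to be enlarged in order to contain all
intrinsic means with weights `w`. -/
noncomputable def meanRadius (w : ι → ℝ) : ℝ := 4 * (∑ j, |w j|) / (∑ j, w j) + 1

/-- If the data lie in the ball of radius `D` about `o`, then all points that are at least as good
as `o` for the sum of weighted squared distances lie in the ball of radius `meanRadius w * D`. The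
sum at `v` is `(∑ j, w j) * dist v o ^ 2` up to terms that are linear in `dist v o`. -/
theorem dist_le_meanRadius_mul {w : ι → ℝ} (hw : 0 < ∑ j, w j) {x : ι → M} {o v : M} {D : ℝ}
    (hx : ∀ j, dist (x j) o ≤ D)
    (hv : ∑ j, w j * dist v (x j) ^ 2 ≤ ∑ j, w j * dist o (x j) ^ 2) :
    dist v o ≤ meanRadius w * D := by
  have hne : Nonempty ι := by
    by_contra h
    rw [not_nonempty_iff] at h
    simp at hw
  have hD : 0 ≤ D := dist_nonneg.trans (hx hne.some)
  set t := dist v o with ht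
  have ht0 : 0 ≤ t := dist_nonneg
  set W := ∑ j, |w j| with hW
  set σ := ∑ j, w j with hσ
  have hW0 : 0 ≤ W := Finset.sum_nonneg fun j _ => abs_nonneg _
  have h1 : ∀ j, w j * t ^ 2 - |w j| * (D * (2 * t + D)) ≤ w j * dist v (x j) ^ 2 := by
    intro j
    have a1 : |dist v (x j) ^ 2 - t ^ 2| ≤ D * (2 * t + D) := by
      rw [sq_sub_sq, abs_mul, mul_comm]
      have b1 : |dist v (x j) - t| ≤ D := by
        rw [ht, dist_comm v (x j), dist_comm v o]
        exact (abs_dist_sub_le (x j) o v).trans (hx j)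
      have b2 : |dist v (x j) + t| ≤ 2 * t + D := by
        rw [abs_of_nonneg (by positivity)]
        linarith [(abs_le.1 b1).2]
      gcongr
    have a2 : |w j * (dist v (x j) ^ 2 - t ^ 2)| ≤ |w j| * (D * (2 * t + D)) := by
      rw [abs_mul]; gcongr
    have := (abs_le.1 a2).1
    linarith
  have h2 : ∀ j, w j * dist o (x j) ^ 2 ≤ |w j| * D ^ 2 := by
    intro j
    have a1 : dist o (x j) ≤ D := by rw [dist_comm]; exact hx j
    gcongr
    exact le_abs_self _
  have h3 : σ * t ^ 2 - W * (D * (2 * t + D)) ≤ W * D ^ 2 := by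
    calc σ * t ^ 2 - W * (D * (2 * t + D))
        = ∑ j, (w j * t ^ 2 - |w j| * (D * (2 * t + D))) := by
          rw [Finset.sum_sub_distrib, Finset.sum_mul, Finset.sum_mul]
      _ ≤ ∑ j, w j * dist v (x j) ^ 2 := Finset.sum_le_sum fun j _ => h1 j
      _ ≤ ∑ j, w j * dist o (x j) ^ 2 := hv
      _ ≤ ∑ j, |w j| * D ^ 2 := Finset.sum_le_sum fun j _ => h2 j
      _ = W * D ^ 2 := by rw [Finset.sum_mul]
  by_contra! hlt
  have h4 : meanRadius w * D = 4 * W * D / σ + D := by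
    rw [meanRadius]; ring
  rw [h4] at hlt
  have h5 : 0 ≤ 4 * W * D / σ := by positivity
  have htD : D < t := by linarith
  have ht1 : 0 < t := by linarith
  have h6 : 4 * W * D < σ * t := by
    have : 4 * W * D / σ < t := by linarith
    rw [div_lt_iff₀ hw] at this
    linarith
  have h7 : W * D * D ≤ W * D * t := by gcongr
  have h8 : 4 * W * D * t < σ * t * t := by gcongr
  nlinarith

theorem intrinsicMean_subset {w : ι → ℝ} (hw : 0 < ∑ j, w j) {x : ι → M} {o : M} {D : ℝ}
    (hx : ∀ j, dist (x j) o ≤ D) {v : M} (hv : v ∈ intrinsicMean w x) :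
    dist v o ≤ meanRadius w * D :=
  dist_le_meanRadius_mul hw hx (hv o)

theorem exists_dist_le (x : ι → M) (o : M) : ∃ D, ∀ j, dist (x j) o ≤ D := by
  obtain ⟨D, hD⟩ := (Set.finite_range fun j => dist (x j) o).bddAbove
  exact ⟨D, fun j => hD (mem_range_self j)⟩

theorem intrinsicMean_nonempty [ProperSpace M] [Nonempty M] {w : ι → ℝ} (hw : 0 < ∑ j, w j)
    (x : ι → M) : (intrinsicMean w x).Nonempty := by
  obtain ⟨o⟩ := ‹Nonempty M›
  obtain ⟨D, hD⟩ := exists_dist_le x o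
  have hcont : Continuous fun v => ∑ j, w j * dist v (x j) ^ 2 := by fun_prop
  have ho : o ∈ Metric.closedBall o (meanRadius w * D) := by
    rw [Metric.mem_closedBall]
    exact dist_le_meanRadius_mul hw hD le_rfl
  obtain ⟨v, -, hv⟩ := (isCompact_closedBall o (meanRadius w * D)).exists_isMinOn ⟨o, ho⟩
    hcont.continuousOn
  refine ⟨v, fun y => ?_⟩
  by_cases hy : y ∈ Metric.closedBall o (meanRadius w * D)
  · exact hv hy
  · refine (isMinOn_iff.1 hv o ho).trans ?_
    by_contra! hlt
    exact hy (Metric.mem_closedBall.2 (dist_le_meanRadius_mul hw hD hlt.le))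

variable (M) in
/-- The graph of the set-valued map `intrinsicMean w` is closed. -/
theorem isClosed_setOf_mem_intrinsicMean (w : ι → ℝ) :
    IsClosed {z : (ι → M) × M | z.2 ∈ intrinsicMean w z.1} := by
  have h : {z : (ι → M) × M | z.2 ∈ intrinsicMean w z.1} =
      ⋂ y : M, {z | ∑ j, w j * dist z.2 (z.1 j) ^ 2 ≤ ∑ j, w j * dist y (z.1 j) ^ 2} := by
    ext z
    simp [intrinsicMean]
  rw [h]
  exact isClosed_iInter fun y => isClosed_le (by fun_prop) (by fun_prop)

theorem isClosed_intrinsicMean (w : ι → ℝ) (x : ι → M) : IsClosed (intrinsicMean w x) :=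
  (isClosed_setOf_mem_intrinsicMean M w).preimage (Continuous.prodMk_right x)

/-- The distance to the set of means is lower semicontinuous: the means are locally bounded and
their graph is closed. -/
theorem lowerSemicontinuous_infDist_intrinsicMean [ProperSpace M] [Nonempty M] {w : ι → ℝ}
    (hw : 0 < ∑ j, w j) {X : Type*} [TopologicalSpace X] {x : X → ι → M} {y : X → M}
    (hx : Continuous x) (hy : Continuous y) :
    LowerSemicontinuous fun u => Metric.infDist (y u) (intrinsicMean w (x u)) := by
  have key : ∀ c, IsClosed {z : (ι → M) × M | Metric.infDist z.2 (intrinsicMean w z.1) ≤ c} := by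
    intro c
    refine IsSeqClosed.isClosed fun z z₀ hz hlim => ?_
    have hz' : ∀ n, ∃ v ∈ intrinsicMean w (z n).1, dist (z n).2 v ≤ c := by
      intro n
      obtain ⟨v, hv, hvd⟩ := (isClosed_intrinsicMean w (z n).1).exists_infDist_eq_dist
        (intrinsicMean_nonempty hw _) (z n).2
      exact ⟨v, hv, hvd ▸ hz n⟩
    choose v hv hvc using hz'
    have hbd : Bornology.IsBounded (range v) := by
      obtain ⟨r, hr⟩ := (Metric.isBounded_range_of_tendsto z hlim).subset_closedBall z₀
      rw [Metric.isBounded_iff_subset_closedBall z₀.2]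
      refine ⟨c + r, ?_⟩
      rintro _ ⟨n, rfl⟩
      have h1 : dist (z n) z₀ ≤ r := hr (mem_range_self n)
      have h2 : dist (z n).2 z₀.2 ≤ r := (le_max_right _ _).trans h1
      rw [Metric.mem_closedBall]
      linarith [dist_triangle (v n) (z n).2 z₀.2, hvc n, dist_comm (v n) (z n).2]
    obtain ⟨v₀, -, φ, hφ, hv₀⟩ := tendsto_subseq_of_bounded hbd (fun n => mem_range_self n)
    have hlim' := hlim.comp hφ.tendsto_atTop
    have h1 : v₀ ∈ intrinsicMean w z₀.1 :=
      (isClosed_setOf_mem_intrinsicMean M w).mem_of_tendsto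
        (((continuous_fst.tendsto z₀).comp hlim').prodMk_nhds hv₀)
        (Filter.Eventually.of_forall fun n => hv (φ n))
    have h2 : dist z₀.2 v₀ ≤ c :=
      le_of_tendsto' (((continuous_snd.tendsto z₀).comp hlim').dist hv₀) fun n => hvc (φ n)
    exact (Metric.infDist_le_dist_of_mem h1).trans h2
  rw [lowerSemicontinuous_iff_isClosed_preimage]
  intro c
  exact (key c).preimage (hx.prodMk hy)

/-- Nonnegativity is needed since `t ↦ t ^ p` is not monotone on the negative reals. -/
theorem lowerSemicontinuous_rpow {X : Type*} [TopologicalSpace X] {g : X → ℝ} {p : ℝ} (hp : 0 < p)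
    (hg : LowerSemicontinuous g) (hg0 : ∀ u, 0 ≤ g u) : LowerSemicontinuous fun u => g u ^ p := by
  have hcont : Continuous fun t : ℝ => max t 0 ^ p :=
    (continuous_id.max continuous_const).rpow_const fun _ => Or.inr hp.le
  have hmono : Monotone fun t : ℝ => max t 0 ^ p := fun a b hab =>
    Real.rpow_le_rpow (le_max_right _ _) (max_le_max_right 0 hab) hp.le
  have := hcont.comp_lowerSemicontinuous hg hmono
  have h : (fun t : ℝ => max t 0 ^ p) ∘ g = fun u => g u ^ p := by
    funext u
    simp [hg0 u]
  rwa [h] at this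

theorem lowerSemicontinuous_const_mul {X : Type*} [TopologicalSpace X] {g : X → ℝ} {c : ℝ}
    (hc : 0 ≤ c) (hg : LowerSemicontinuous g) : LowerSemicontinuous fun u => c * g u :=
  (continuous_const_mul c).comp_lowerSemicontinuous hg (monotone_mul_left_of_nonneg hc)

theorem le_rpow_inv_of_rpow_le {a b p : ℝ} (hp : 0 < p) (ha : 0 ≤ a) (h : a ^ p ≤ b) :
    a ≤ b ^ p⁻¹ := by
  have := Real.rpow_le_rpow (by positivity) h (inv_nonneg.2 hp.le)
  rwa [Real.rpow_rpow_inv ha hp.ne'] at this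

/-- The direct method of the calculus of variations in a proper space. -/
theorem exists_forall_le_of_isBounded_sublevel {X : Type*} [MetricSpace X]
    [ProperSpace X] {g : X → ℝ} (hg : LowerSemicontinuous g) (u₀ : X)
    (hb : Bornology.IsBounded {u | g u ≤ g u₀}) : ∃ u, ∀ v, g u ≤ g v := by
  have hc : IsCompact {u | g u ≤ g u₀} :=
    Metric.isCompact_of_isClosed_isBounded (hg.isClosed_preimage (g u₀)) hb
  obtain ⟨u, hu, hmin⟩ := LowerSemicontinuousOn.exists_isMinOn ⟨u₀, le_refl (g u₀)⟩ hc
    (hg.lowerSemicontinuousOn _)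
  refine ⟨u, fun v => ?_⟩
  rcases le_total (g v) (g u₀) with h | h
  · exact isMinOn_iff.1 hmin v h
  · exact le_trans hu h

end Mean

/-! ### The data term -/

section DataTerm

variable {M : Type*} [MetricSpace M] {ι κ : Type*}

/-- Selecting the means closest to `f i` does not change the distance to `f i`. -/
theorem infDist_selected_eq [ProperSpace M] (A : (ι → M) → κ → Set M) (f : κ → M) (u : ι → M)
    (i : κ) (hcl : IsClosed (A u i)) (hne : (A u i).Nonempty) :
    Metric.infDist (f i) (selected A f u i) = Metric.infDist (f i) (A u i) := by
  obtain ⟨v, hv, hvd⟩ := hcl.exists_infDist_eq_dist hne (f i)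
  have hmem : v ∈ selected A f u i := by
    refine ⟨hv, fun w hw => ?_⟩
    rw [dist_comm v, dist_comm w, ← hvd]
    exact Metric.infDist_le_dist_of_mem hw
  refine le_antisymm ?_ (Metric.infDist_le_infDist_of_subset (fun _ h => h.1) ⟨v, hmem⟩)
  rw [hvd]
  exact Metric.infDist_le_dist_of_mem hmem

variable [Fintype κ] {p : ℝ}

theorem dataTerm_nonneg (A : (ι → M) → κ → Set M) (f : κ → M) (u : ι → M) :
    0 ≤ dataTerm p A f u :=
  Finset.sum_nonneg fun _ _ => Real.rpow_nonneg Metric.infDist_nonneg _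

theorem infDist_selected_le (hp : 0 < p) {A : (ι → M) → κ → Set M} {f : κ → M} {u : ι → M} {B : ℝ}
    (h : dataTerm p A f u ≤ B) (i : κ) : Metric.infDist (f i) (selected A f u i) ≤ B ^ p⁻¹ := by
  refine le_rpow_inv_of_rpow_le hp Metric.infDist_nonneg (le_trans ?_ h)
  exact Finset.single_le_sum
    (f := fun i => Metric.infDist (f i) (selected A f u i) ^ p)
    (fun _ _ => Real.rpow_nonneg Metric.infDist_nonneg _) (Finset.mem_univ i)

theorem dataTerm_idOperator (f u : κ → M) :
    dataTerm p idOperator f u = ∑ i, dist (f i) (u i) ^ p := by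
  refine Finset.sum_congr rfl fun i _ => ?_
  have : selected idOperator f u i = {u i} := by
    ext v
    simp only [selected, idOperator, mem_ofPred_eq, mem_singleton_iff, forall_eq]
    exact ⟨fun h => h.1, fun h => ⟨h, by rw [h]⟩⟩
  rw [this, Metric.infDist_singleton]

variable [Fintype ι]

theorem lowerSemicontinuous_dataTerm_meanOperator [ProperSpace M] [Nonempty M] (hp : 0 < p)
    {a : Matrix κ ι ℝ} (ha : ∀ i, 0 < ∑ j, a i j) (f : κ → M) :
    LowerSemicontinuous (dataTerm p (meanOperator a) f) := by
  refine lowerSemicontinuous_sum fun i _ => lowerSemicontinuous_rpow hp ?_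
    fun _ => Metric.infDist_nonneg
  have h : ∀ u : ι → M, Metric.infDist (f i) (selected (meanOperator a) f u i) =
      Metric.infDist (f i) (intrinsicMean (a i) u) := fun u =>
    infDist_selected_eq _ f u i (isClosed_intrinsicMean _ _) (intrinsicMean_nonempty (ha i) u)
  simp only [h]
  exact lowerSemicontinuous_infDist_intrinsicMean (ha i) continuous_id continuous_const

end DataTerm

/-! ### Grids and the regularizer -/

section Sample

theorem continuous_sample {M : Type*} [TopologicalSpace M] {s : ℕ} {N' : Fin s → ℕ} {R : ℕ}
    (r : ℕ) (hr : r ≤ R) :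

    Continuous fun u : Grid (levelSize N' R) → M => sample u r hr :=
  continuous_pi fun _ => continuous_apply _

/-- The samples at the finest level `R` are the signal itself. -/
theorem sample_top {M : Type*} {s : ℕ} {N' : Fin s → ℕ} {R : ℕ} (u : Grid (levelSize N' R) → M) :
    sample u R le_rfl = u := by
  funext n
  unfold sample
  congr 1
  funext ν
  ext
  simp

theorem sum_pred {s : ℕ} {N : Fin s → ℕ} (n : Grid N) (i : Fin s) (hi : 0 < (n i : ℕ)) :
    ∑ ν, (pred n i ν : ℕ) + 1 = ∑ ν, (n ν : ℕ) := by
  rw [← Finset.add_sum_erase _ _ (Finset.mem_univ i),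
    ← Finset.add_sum_erase (Finset.univ : Finset (Fin s)) (fun ν => (n ν : ℕ)) (Finset.mem_univ i)]
  have h1 : ∑ ν ∈ Finset.univ.erase i, (pred n i ν : ℕ) =
      ∑ ν ∈ Finset.univ.erase i, (n ν : ℕ) := by
    refine Finset.sum_congr rfl fun ν hν => ?_
    rw [pred, Function.update_of_ne (Finset.ne_of_mem_erase hν)]
  have h2 : (pred n i i : ℕ) = (n i : ℕ) - 1 := by
    rw [pred, Function.update_self]
  rw [h1, h2]
  omega

/-- If neighbouring items of a grid of points have distance at most `c`, then the distance to the
item with index `0` is at most `c` times the `ℓ¹` norm of the index. -/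
theorem dist_le_mul_sum_of_pred {M : Type*} [MetricSpace M] {s : ℕ} {N : Fin s → ℕ}
    (x : Grid N → M) (c : ℝ)
    (h : ∀ n i, 0 < (n i : ℕ) → dist (x (pred n i)) (x n) ≤ c) (n₀ : Grid N)
    (hn₀ : ∀ ν, (n₀ ν : ℕ) = 0) :
    ∀ n, dist (x n) (x n₀) ≤ c * ((∑ ν, (n ν : ℕ) : ℕ) : ℝ) := by
  suffices H : ∀ k : ℕ, ∀ n : Grid N, ∑ ν, (n ν : ℕ) = k → dist (x n) (x n₀) ≤ c * (k : ℝ) from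
    fun n => H _ n rfl
  intro k
  induction k with
  | zero =>
    intro n hn
    have : n = n₀ := by
      funext ν
      ext
      rw [hn₀ ν]
      exact Finset.sum_eq_zero_iff.1 hn ν (Finset.mem_univ ν)
    rw [this]
    simp
  | succ k ih =>
    intro n hn
    obtain ⟨i, -, hi⟩ : ∃ i ∈ Finset.univ, (n i : ℕ) ≠ 0 := by
      by_contra! hall
      rw [Finset.sum_eq_zero hall] at hn
      omega
    have hi' : 0 < (n i : ℕ) := Nat.pos_of_ne_zero hi
    have h1 := ih (pred n i) (by have := sum_pred n i hi'; omega)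
    have h2 := h n i hi'
    push_cast
    linarith [dist_triangle (x n) (x (pred n i)) (x n₀), dist_comm (x n) (x (pred n i))]

end Sample

section Regularizer

variable {d : ℕ} {M : Type*} [MetricSpace M]
    [ChartedSpace (EuclideanSpace ℝ (Fin d)) M] [IsManifold (𝓡 d) ∞ M]
    [RiemannianBundle (fun x : M => TangentSpace (𝓡 d) x)]
  {s : ℕ} {N' : Fin s → ℕ} {R : ℕ} (S : InterpolatoryScheme N')

theorem InterpolatoryScheme.sum_weights_pos (r : ℕ) (n : Grid (levelSize N' (r + 1))) :
    0 < ∑ j, S.weights r n j := by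
  rw [S.weights_reproduces]
  exact one_pos

theorem detailNorm_nonneg (u : Grid (levelSize N' R) → M) (r : Fin R)
    (n : Grid (levelSize N' (r + 1))) : 0 ≤ detailNorm d S u r n := by
  refine Real.sInf_nonneg ?_
  rintro _ ⟨δ, -, rfl⟩
  exact norm_nonneg _

omit [IsManifold (𝓡 d) ∞ M] in
theorem norm_mk_smul (v : TangentBundle (𝓡 d) M) {c : ℝ} (hc : 0 ≤ c) :
    ‖(⟨v.1, c • v.2⟩ : TangentBundle (𝓡 d) M).2‖ = c * ‖v.2‖ := by
  rw [norm_smul, Real.norm_of_nonneg hc]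

/-- The factor `2 ^ (-s (r + 1) / 2)` in the definition of the detail. -/
noncomputable def detailScale (s r : ℕ) : ℝ := (2 : ℝ) ^ (-((s : ℝ) * ((r : ℝ) + 1) / 2))

theorem detailScale_pos (s r : ℕ) : 0 < detailScale s r := by
  unfold detailScale
  positivity

theorem regularizer_nonneg {α q l₁ : ℝ} (hl₁ : 0 < l₁) (u : Grid (levelSize N' R) → M) :
    0 ≤ regularizer d S α q l₁ 0 u := by
  simp only [regularizer, zero_mul, add_zero]
  refine mul_nonneg hl₁.le (Finset.sum_nonneg fun r _ => Finset.sum_nonneg fun n _ => ?_)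
  exact mul_nonneg (by positivity) (Real.rpow_nonneg (detailNorm_nonneg S u r n) q)

variable [IsRiemannianManifold (𝓡 d) M] [IsContMDiffRiemannianBundle (𝓡 d) ∞
  (EuclideanSpace ℝ (Fin d)) (fun x : M => TangentSpace (𝓡 d) x)] [ProperSpace M] [Nonempty M]

/-- The norm of the detail is the rescaled distance between the item and the set of its
predictions. -/
theorem detailNorm_eq (u : Grid (levelSize N' R) → M) (r : Fin R)
    (n : Grid (levelSize N' (r + 1))) :
    detailNorm d S u r n = detailScale s r *
      Metric.infDist (sample u (r + 1) r.2 n) (S.predict r (sample u r r.2.le) n) := by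
  set y := sample u (r + 1) r.2 n with hy
  set P := S.predict r (sample u r r.2.le) n with hP
  obtain ⟨o, ho, hod⟩ := (isClosed_intrinsicMean (S.weights r n)
    (sample u r r.2.le)).exists_infDist_eq_dist
    (intrinsicMean_nonempty (S.sum_weights_pos r n) _) y
  obtain ⟨v, hv, hvn⟩ := exists_mem_expInv_norm_eq_dist d o y
  have hc := (detailScale_pos s r).le
  set c := detailScale s r with hcdef
  have hmem : (⟨v.1, c • v.2⟩ : TangentBundle (𝓡 d) M) ∈ detailCandidates S u r n :=
    ⟨o, ho, v, hv, rfl⟩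
  have hnorm : ‖(⟨v.1, c • v.2⟩ : TangentBundle (𝓡 d) M).2‖ = c * Metric.infDist y P := by
    rw [norm_mk_smul v hc, hvn, dist_comm]
    exact congrArg _ hod.symm
  have hle : ∀ δ ∈ detailCandidates (d := d) S u r n, c * Metric.infDist y P ≤ ‖δ.2‖ := by
    rintro _ ⟨o', ho', v', hv', rfl⟩
    refine le_of_le_of_eq ?_ (norm_mk_smul v' hc).symm
    gcongr
    refine (Metric.infDist_le_dist_of_mem ho').trans ?_
    rw [dist_comm]
    exact dist_le_norm_of_mem_expInv hv'
  have himg : (fun δ : TangentBundle (𝓡 d) M => ‖δ.2‖) '' detail S u r n =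
      {c * Metric.infDist y P} := by
    ext t
    constructor
    · rintro ⟨δ, ⟨hδ, hmin⟩, rfl⟩
      exact le_antisymm ((hmin _ hmem).trans_eq hnorm) (hle δ hδ)
    · rintro rfl
      exact ⟨_, ⟨hmem, fun δ' hδ' => hnorm.trans_le (hle δ' hδ')⟩, hnorm⟩
  rw [detailNorm, himg, csInf_singleton]

variable {α q l₁ : ℝ}

theorem lowerSemicontinuous_regularizer (hq : 0 < q) (hl₁ : 0 < l₁) :
    LowerSemicontinuous fun u : Grid (levelSize N' R) → M => regularizer d S α q l₁ 0 u := by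
  simp only [regularizer, zero_mul, add_zero]
  refine lowerSemicontinuous_const_mul hl₁.le ?_
  refine lowerSemicontinuous_sum fun r _ => lowerSemicontinuous_sum fun n _ => ?_
  refine lowerSemicontinuous_const_mul (by positivity) ?_
  refine lowerSemicontinuous_rpow hq ?_ fun u => detailNorm_nonneg S u r n
  simp only [detailNorm_eq S]
  refine lowerSemicontinuous_const_mul (detailScale_pos s r).le ?_
  exact lowerSemicontinuous_infDist_intrinsicMean (S.sum_weights_pos r n)
    (continuous_sample r r.2.le)
    ((continuous_apply n).comp (continuous_sample (r + 1) r.2))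

/-- Constant signals are predicted exactly, since the weights sum up to `1`. -/
theorem regularizer_const (hq : 0 < q) (y : M) :
    regularizer d S α q l₁ 0 (fun _ : Grid (levelSize N' R) => y) = 0 := by
  simp only [regularizer, zero_mul, add_zero]
  refine mul_eq_zero_of_right _ (Finset.sum_eq_zero fun r _ => Finset.sum_eq_zero fun n _ => ?_)
  have hmem : y ∈ S.predict r (sample (fun _ : Grid (levelSize N' R) => y) r r.2.le) n := by
    have e : ∀ z, ∑ j, S.weights r n j *
        dist z (sample (fun _ : Grid (levelSize N' R) => y) r r.2.le j) ^ 2 = dist z y ^ 2 := by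
      intro z
      simp only [sample, ← Finset.sum_mul, S.weights_reproduces, one_mul]
    intro z
    rw [e, e, dist_self, zero_pow two_ne_zero]
    positivity
  rw [detailNorm_eq]
  have : Metric.infDist (sample (fun _ : Grid (levelSize N' R) => y) (r + 1) r.2 n)
      (S.predict r (sample (fun _ : Grid (levelSize N' R) => y) r r.2.le) n) = 0 :=
    Metric.infDist_zero_of_mem hmem
  rw [this, mul_zero, Real.zero_rpow hq.ne', mul_zero]

/-- On sublevel sets of the regularizer, items are at bounded distance from their predictions. -/
theorem exists_infDist_predict_le (hq : 0 < q) (hl₁ : 0 < l₁) (E₀ : ℝ) (r : Fin R)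
    (n : Grid (levelSize N' (r + 1))) : ∃ B, ∀ u : Grid (levelSize N' R) → M,
      regularizer d S α q l₁ 0 u ≤ E₀ →
      Metric.infDist (sample u (r + 1) r.2 n) (S.predict r (sample u r r.2.le) n) ≤ B := by
  have hk : (0 : ℝ) < 2 ^ (((r : ℝ) + 1) * q * (α + (s : ℝ) / 2 - (s : ℝ) / q)) := by positivity
  refine ⟨(E₀ / (l₁ * 2 ^ (((r : ℝ) + 1) * q * (α + (s : ℝ) / 2 - (s : ℝ) / q)))) ^ q⁻¹ /
    detailScale s r, fun u hu => ?_⟩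
  rw [le_div_iff₀ (detailScale_pos s r), mul_comm, ← detailNorm_eq (d := d) S u r n]
  refine le_rpow_inv_of_rpow_le hq (detailNorm_nonneg S u r n) ?_
  rw [le_div_iff₀ (by positivity)]
  simp only [regularizer, zero_mul, add_zero] at hu
  refine le_trans ?_ hu
  have hterm : ∀ (r : Fin R) (n : Grid (levelSize N' (r + 1))),
      0 ≤ (2 : ℝ) ^ (((r : ℝ) + 1) * q * (α + (s : ℝ) / 2 - (s : ℝ) / q)) *
        detailNorm d S u r n ^ q := fun r n =>
    mul_nonneg (by positivity) (Real.rpow_nonneg (detailNorm_nonneg S u r n) q)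
  have h1 := Finset.single_le_sum (fun n _ => hterm r n) (Finset.mem_univ n)
  have h2 := Finset.single_le_sum
    (fun r _ => Finset.sum_nonneg fun n (_ : n ∈ Finset.univ) => hterm r n) (Finset.mem_univ r)
  calc detailNorm d S u r n ^ q *
        (l₁ * 2 ^ (((r : ℝ) + 1) * q * (α + (s : ℝ) / 2 - (s : ℝ) / q)))
      = l₁ * (2 ^ (((r : ℝ) + 1) * q * (α + (s : ℝ) / 2 - (s : ℝ) / q)) *
        detailNorm d S u r n ^ q) := by ring
    _ ≤ _ := by
      gcongr
      exact h1.trans h2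

/-- A bound on the coarsest level and on the regularizer propagates to all levels: predictions
stay close to the coarse data, and items stay close to their predictions. -/
theorem exists_dist_sample_le (hq : 0 < q) (hl₁ : 0 < l₁) (E₀ D₀ : ℝ) (r : ℕ) (hr : r ≤ R) :
    ∃ D, ∀ (u : Grid (levelSize N' R) → M) (o : M), regularizer d S α q l₁ 0 u ≤ E₀ →
      (∀ n, dist (sample u 0 (Nat.zero_le R) n) o ≤ D₀) → ∀ n, dist (sample u r hr n) o ≤ D := by
  induction r with
  | zero => exact ⟨D₀, fun u o _ h => h⟩
  | succ r ih =>
    obtain ⟨D, hD⟩ := ih (Nat.le_of_succ_le hr)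
    choose B hB using fun n : Grid (levelSize N' (r + 1)) =>
      exists_infDist_predict_le (d := d) (M := M) (α := α) S hq hl₁ E₀ ⟨r, hr⟩ n
    obtain ⟨D', hD'⟩ := (Set.finite_range fun n : Grid (levelSize N' (r + 1)) =>
      B n + meanRadius (S.weights r n) * D).bddAbove
    refine ⟨D', fun u o hu ho n => le_trans ?_ (hD' (mem_range_self n))⟩
    obtain ⟨v, hv, hvd⟩ := (isClosed_intrinsicMean (S.weights r n)
      (sample u r (Nat.le_of_succ_le hr))).exists_infDist_eq_dist
      (intrinsicMean_nonempty (S.sum_weights_pos r n) _) (sample u (r + 1) hr n)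
    have h1 := intrinsicMean_subset (S.sum_weights_pos r n) (hD u o hu ho) hv
    have h2 := hB n u hu
    have h3 : dist (sample u (r + 1) hr n) v ≤ B n := hvd.symm.le.trans h2
    linarith [dist_triangle (sample u (r + 1) hr n) v o]

end Regularizer

/-! ### Existence of minimizers -/

section Coercivity

variable {d : ℕ} {M : Type*} [MetricSpace M]
    [ChartedSpace (EuclideanSpace ℝ (Fin d)) M] [IsManifold (𝓡 d) ∞ M]
    [RiemannianBundle (fun x : M => TangentSpace (𝓡 d) x)]
  {s : ℕ} {N' : Fin s → ℕ} {R : ℕ} (S : InterpolatoryScheme N') {p q α l₁ : ℝ}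

/-- For the identity, the data term alone has bounded sublevel sets. -/
theorem isBounded_sublevel_idOperator (hp : 0 < p) (hl₁ : 0 < l₁)
    (f : Grid (levelSize N' R) → M) (E₀ : ℝ) :
    Bornology.IsBounded {u : Grid (levelSize N' R) → M |
      dataTerm p idOperator f u + regularizer d S α q l₁ 0 u ≤ E₀} := by
  refine Metric.isBounded_closedBall (x := f) (r := |E₀ ^ p⁻¹|) |>.subset fun u hu => ?_
  have hdata : dataTerm p idOperator f u ≤ E₀ :=
    le_trans (le_add_of_nonneg_right (regularizer_nonneg S hl₁ u)) hu
  rw [dataTerm_idOperator] at hdata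
  rw [Metric.mem_closedBall, dist_comm]
  refine (dist_pi_le_iff (abs_nonneg _)).2 fun n => le_trans ?_ (le_abs_self _)
  refine le_rpow_inv_of_rpow_le hp dist_nonneg (le_trans ?_ hdata)
  exact Finset.single_le_sum (f := fun n => dist (f n) (u n) ^ p)
    (fun _ _ => Real.rpow_nonneg dist_nonneg _) (Finset.mem_univ n)

variable [IsRiemannianManifold (𝓡 d) M] [IsContMDiffRiemannianBundle (𝓡 d) ∞
    (EuclideanSpace ℝ (Fin d)) (fun x : M => TangentSpace (𝓡 d) x)] [ProperSpace M] [Nonempty M]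
  {κ : Type*} [Fintype κ] {a : Matrix κ (Grid (levelSize N' R)) ℝ} {f : κ → M}

theorem lowerSemicontinuous_energy (hp : 0 < p) (hq : 0 < q) (hl₁ : 0 < l₁)
    (ha : ∀ i, 0 < ∑ j, a i j) :
    LowerSemicontinuous fun u : Grid (levelSize N' R) → M =>
      dataTerm p (meanOperator a) f u + regularizer d S α q l₁ 0 u :=
  (lowerSemicontinuous_dataTerm_meanOperator hp ha f).add
    (lowerSemicontinuous_regularizer S hq hl₁)

/-- Under the bound on the coarsest level, the energy has bounded sublevel sets. -/
theorem isBounded_sublevel (hp : 0 < p) (hq : 0 < q) (hl₁ : 0 < l₁) [hκ : Nonempty κ]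
    (ha : ∀ i, 0 < ∑ j, a i j) {C : ℝ} (hC : 0 < C)
    (hcoarse : ∀ (u : Grid (levelSize N' R) → M) (n : Grid (levelSize N' 0)) (i : Fin s),
      0 < (n i : ℕ) →
      dist (sample u 0 (Nat.zero_le R) (pred n i)) (sample u 0 (Nat.zero_le R) n) ≤
        C * max (imageDiam (meanOperator a) f u) (regularizer d S α q l₁ 0 u)) (E₀ : ℝ) :
    Bornology.IsBounded {u : Grid (levelSize N' R) → M |
      dataTerm p (meanOperator a) f u + regularizer d S α q l₁ 0 u ≤ E₀} := by
  obtain ⟨i₀⟩ := hκ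
  -- the grid is nonempty, since the weights of an item of the image have a positive sum
  obtain ⟨m⟩ : Nonempty (Grid (levelSize N' R)) := by
    by_contra h
    rw [not_nonempty_iff] at h
    simpa using ha i₀
  have hpos : ∀ ν, 0 < levelSize N' 0 ν := fun ν => by
    have h1 : 0 < 2 ^ R * N' ν := (m ν).pos
    have h2 : 0 < N' ν := Nat.pos_of_mul_pos_left h1
    simpa [levelSize] using h2
  let n₀ : Grid (levelSize N' 0) := fun ν => ⟨0, hpos ν⟩
  obtain ⟨F, hF⟩ := exists_dist_le f (f i₀)
  set B := E₀ ^ p⁻¹ with hB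
  set c := C * max (2 * (F + |B|)) E₀ with hc
  obtain ⟨D₀, hD₀⟩ := (Set.finite_range fun n : Grid (levelSize N' 0) =>
    c * ((∑ ν, (n ν : ℕ) : ℕ) : ℝ)).bddAbove
  obtain ⟨D, hD⟩ := exists_dist_sample_le (d := d) (M := M) (α := α) S hq hl₁ E₀ D₀ R le_rfl
  have hF0 : 0 ≤ F := dist_nonneg.trans (hF i₀)
  refine Metric.isBounded_closedBall (x := fun _ => f i₀)
    (r := D + (meanRadius (a i₀) * D + B)) |>.subset fun u hu => ?_
  have hdata : dataTerm p (meanOperator a) f u ≤ E₀ :=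
    le_trans (le_add_of_nonneg_right (regularizer_nonneg S hl₁ u)) hu
  have hreg : regularizer d S α q l₁ 0 u ≤ E₀ :=
    le_trans (le_add_of_nonneg_left (dataTerm_nonneg _ f u)) hu
  have hcl : ∀ i, IsClosed (meanOperator a u i) := fun i => isClosed_intrinsicMean _ _
  have hne : ∀ i, (meanOperator a u i).Nonempty := fun i => intrinsicMean_nonempty (ha i) u
  have hitem : ∀ i, Metric.infDist (f i) (meanOperator a u i) ≤ B := fun i => by
    rw [← infDist_selected_eq (meanOperator a) f u i (hcl i) (hne i)]
    exact infDist_selected_le hp hdata i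
  have hdiam : imageDiam (meanOperator a) f u ≤ 2 * (F + |B|) := by
    refine Metric.diam_le_of_subset_closedBall (by positivity) (x := f i₀) ?_
    refine iUnion_subset fun i v hv => ?_
    obtain ⟨w, hw, hwd⟩ := (hcl i).exists_infDist_eq_dist (hne i) (f i)
    have h1 : dist v (f i) ≤ B := by
      refine (hv.2 w hw).trans ?_
      rw [dist_comm, ← hwd]
      exact hitem i
    rw [Metric.mem_closedBall]
    linarith [dist_triangle v (f i) (f i₀), hF i, le_abs_self B]
  have hneigh : ∀ n i, 0 < (n i : ℕ) →
      dist (sample u 0 (Nat.zero_le R) (pred n i)) (sample u 0 (Nat.zero_le R) n) ≤ c := by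
    intro n i hi
    refine (hcoarse u n i hi).trans ?_
    rw [hc]
    gcongr
  set o := sample u 0 (Nat.zero_le R) n₀ with ho
  have hlevel : ∀ n, dist (u n) o ≤ D := by
    have h1 := hD u o hreg fun n =>
      (dist_le_mul_sum_of_pred _ c hneigh n₀ (fun _ => rfl) n).trans (hD₀ (mem_range_self n))
    rwa [sample_top] at h1
  obtain ⟨w, hw, hwd⟩ := (hcl i₀).exists_infDist_eq_dist (hne i₀) (f i₀)
  have h2 : dist w o ≤ meanRadius (a i₀) * D := intrinsicMean_subset (ha i₀) hlevel hw
  have h3 : dist (f i₀) w ≤ B := hwd.symm.le.trans (hitem i₀)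
  have hn : ∀ n, dist (u n) (f i₀) ≤ D + (meanRadius (a i₀) * D + B) := fun n => by
    linarith [dist_triangle (u n) o (f i₀), dist_triangle o w (f i₀), hlevel n,
      dist_comm o w, dist_comm w (f i₀)]
  rw [Metric.mem_closedBall]
  exact (dist_pi_le_iff (dist_nonneg.trans (hn m))).2 hn

end Coercivity

end WaveletReg

theorem mainTheorem2 {d : ℕ} {M : Type*} [MetricSpace M]
    [ChartedSpace (EuclideanSpace ℝ (Fin d)) M] [IsManifold (𝓡 d) ∞ M]
    [RiemannianBundle (fun x : M => TangentSpace (𝓡 d) x)]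
    [IsContMDiffRiemannianBundle (𝓡 d) ∞ (EuclideanSpace ℝ (Fin d))
      (fun x : M => TangentSpace (𝓡 d) x)]
    [IsRiemannianManifold (𝓡 d) M] [CompleteSpace M] [ConnectedSpace M]
    {s : ℕ} (N' : Fin s → ℕ) (R : ℕ) (S : WaveletReg.InterpolatoryScheme N')
    (p q α l₁ : ℝ) (hp : 0 < p) (hq : 0 < q) (hl₁ : 0 < l₁) :
    -- existence under the bound on the coarsest level
    (∀ (s' : ℕ) (K : Fin s' → ℕ)
        (a : Matrix (WaveletReg.Grid K) (WaveletReg.Grid (WaveletReg.levelSize N' R)) ℝ)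
        (f : WaveletReg.Grid K → M),
      (∀ i, 0 < ∑ j, a i j) →
      (∃ C : ℝ, 0 < C ∧ ∀ (u : WaveletReg.Grid (WaveletReg.levelSize N' R) → M)
        (n : WaveletReg.Grid (WaveletReg.levelSize N' 0)) (i : Fin s), 0 < (n i : ℕ) →
        dist (WaveletReg.sample u 0 (Nat.zero_le R) (WaveletReg.pred n i))
            (WaveletReg.sample u 0 (Nat.zero_le R) n) ≤
          C * max (WaveletReg.imageDiam (WaveletReg.meanOperator a) f u)
            (WaveletReg.regularizer d S α q l₁ 0 u)) →
      ∃ u : WaveletReg.Grid (WaveletReg.levelSize N' R) → M,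
        ∀ v : WaveletReg.Grid (WaveletReg.levelSize N' R) → M,
          WaveletReg.dataTerm p (WaveletReg.meanOperator a) f u
              + WaveletReg.regularizer d S α q l₁ 0 u ≤
            WaveletReg.dataTerm p (WaveletReg.meanOperator a) f v
              + WaveletReg.regularizer d S α q l₁ 0 v) ∧
    -- existence for the identity
    (∀ f : WaveletReg.Grid (WaveletReg.levelSize N' R) → M,
      ∃ u : WaveletReg.Grid (WaveletReg.levelSize N' R) → M,
        ∀ v : WaveletReg.Grid (WaveletReg.levelSize N' R) → M,
          WaveletReg.dataTerm p WaveletReg.idOperator f u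
              + WaveletReg.regularizer d S α q l₁ 0 u ≤
            WaveletReg.dataTerm p WaveletReg.idOperator f v
              + WaveletReg.regularizer d S α q l₁ 0 v) ∧
    -- existence on compact manifolds
    (CompactSpace M → ∀ (s' : ℕ) (K : Fin s' → ℕ)
        (a : Matrix (WaveletReg.Grid K) (WaveletReg.Grid (WaveletReg.levelSize N' R)) ℝ)
        (f : WaveletReg.Grid K → M),
      (∀ i, 0 < ∑ j, a i j) →
      ∃ u : WaveletReg.Grid (WaveletReg.levelSize N' R) → M,
        ∀ v : WaveletReg.Grid (WaveletReg.levelSize N' R) → M,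
          WaveletReg.dataTerm p (WaveletReg.meanOperator a) f u
              + WaveletReg.regularizer d S α q l₁ 0 u ≤
            WaveletReg.dataTerm p (WaveletReg.meanOperator a) f v
              + WaveletReg.regularizer d S α q l₁ 0 v) := by
  have : LocallyCompactSpace M := ChartedSpace.locallyCompactSpace (EuclideanSpace ℝ (Fin d)) M
  have : ProperSpace M := (WaveletReg.hasAlmostGeodesics_of_isRiemannianManifold
    (EuclideanSpace ℝ (Fin d)) M).properSpace
  obtain ⟨y⟩ : Nonempty M := inferInstance
  refine ⟨?_, ?_, ?_⟩
  · rintro s' K a f ha ⟨C, hC, hcoarse⟩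
    rcases isEmpty_or_nonempty (WaveletReg.Grid K) with hK | hK
    · -- without data, every constant signal has energy `0`
      refine ⟨fun _ => y, fun v => ?_⟩
      have h1 : ∀ u, WaveletReg.dataTerm p (WaveletReg.meanOperator a) f u = 0 := fun u => by
        simp [WaveletReg.dataTerm]
      rw [h1, h1, zero_add, zero_add, WaveletReg.regularizer_const S hq]
      exact WaveletReg.regularizer_nonneg S hl₁ v
    · exact WaveletReg.exists_forall_le_of_isBounded_sublevel
        (WaveletReg.lowerSemicontinuous_energy S hp hq hl₁ ha) (fun _ => y)
        (WaveletReg.isBounded_sublevel S hp hq hl₁ ha hC hcoarse _)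
  · intro f
    refine WaveletReg.exists_forall_le_of_isBounded_sublevel
      (LowerSemicontinuous.add ?_ (WaveletReg.lowerSemicontinuous_regularizer S hq hl₁))
      f (WaveletReg.isBounded_sublevel_idOperator S hp hl₁ f _)
    have h1 : WaveletReg.dataTerm p WaveletReg.idOperator f =
        fun u => ∑ i, dist (f i) (u i) ^ p := funext fun u => WaveletReg.dataTerm_idOperator f u
    rw [h1]
    refine Continuous.lowerSemicontinuous (continuous_finsetSum _ fun i _ => ?_)
    exact (continuous_const.dist (continuous_apply i)).rpow_const fun _ => Or.inr hp.le
  · intro hM s' K a f ha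
    exact WaveletReg.exists_forall_le_of_isBounded_sublevel
      (WaveletReg.lowerSemicontinuous_energy S hp hq hl₁ ha) (fun _ => y)
      (isCompact_univ.isBounded.subset (subset_univ _))
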